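/- Let $Y$ be the plane $\mathbb C=\{z=x+iy\}$ with the continuous conformal Riemannian metric $\rho\,|dz|$, where $\rho(z)=1/y$ on $P=\{y\ge 1\}$ and $\rho(z)=e^{1-y}$ on $Q=\{y<1\}$. Let $d$ be the associated distance (the infimum of the lengths of $C^1$ curves), $D(a,r)=\{p: d(p,a)<r\}$, and $\mathrm{area}=\rho^2\,dx\,dy$. Then: 1. $(Y,d)$ is a complete metric space, $Y$ is simply connected, and $Y$ is parabolic, i.e. conformally equivalent to the Euclidean plane. 2. $Y$ is a surface of bounded curvature in the sense of Aleksandrov: the distribution $-\Delta\log\rho$ is a locally finite signed measure $\omega$, the curvature measure of $Y$. This $\omega$ is uniquely determined, its positive part is $0$, and its negative part is the restriction of area to $P$. In other words, the curvature is $-1$ (times area) on $P$ and $0$ on $Q$, so it is nowhere positive. 3. For every $r>0$ the disc $D(i,r)$ has finite area, and there is a constant $\epsilon>0$ such that for every $r>0$ $$\int_{D(i,r)}\text{curvature}=\omega(D(i,r))<-\epsilon\cdot\mathrm{area}(D(i,r)).$$ 4. There are constants $c>0$, $C$ and $R$ such that for all $r\ge R$ $$c\,e^{r/2}\le \mathrm{area}(P\cap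 D(i,r))\le C\,e^{r/2},\qquad c\,e^{r/2}\le \mathrm{area}(Q\cap D(i,r))\le C\,e^{r/2}.$$ -/

import Mathlib

open MeasureTheory Bundle Manifold Set
open scoped ContDiff ENNReal

noncomputable section

/-- A conformal Riemannian metric `ρ |dz|` on the plane, with continuous positive density `ρ`. -/
structure ConformalMetric where
  /-- The density `ρ` of the line element `ρ |dz|`. -/
  density : ℂ → ℝ
  continuous_density : Continuous density
  density_pos : ∀ z, 0 < density z

namespace ConformalMetric

/-- The plane endowed with the metric `ρ |dz|`. This is a copy of `ℂ` which does not inherit the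
Euclidean norm and distance; it only has the topology, the smooth structure and the Borel sets
of `ℂ`. -/
def Surface (_g : ConformalMetric) : Type := ℂ

variable (g : ConformalMetric)

instance : TopologicalSpace g.Surface := inferInstanceAs (TopologicalSpace ℂ)
instance : T3Space g.Surface := inferInstanceAs (T3Space ℂ)
instance : ConnectedSpace g.Surface := inferInstanceAs (ConnectedSpace ℂ)
instance : ChartedSpace ℂ g.Surface := inferInstanceAs (ChartedSpace ℂ ℂ)
instance : IsManifold 𝓘(ℝ, ℂ) ∞ g.Surface := inferInstanceAs (IsManifold 𝓘(ℝ, ℂ) ∞ ℂ)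
instance : MeasurableSpace g.Surface := inferInstanceAs (MeasurableSpace ℂ)
instance : BorelSpace g.Surface := inferInstanceAs (BorelSpace ℂ)

/-- The point of the surface with coordinate `z`. -/
def pt (z : ℂ) : g.Surface := z

/-- The coordinate `z` of a point of the surface. -/
def coord (p : g.Surface) : ℂ := p

/-- The bilinear form `(v, w) ↦ ρ(z)² ⟨v, w⟩`. -/
def form (z : ℂ) : ℂ →L[ℝ] ℂ →L[ℝ] ℝ := g.density z ^ 2 • innerSL ℝ

theorem form_apply (z v w : ℂ) : g.form z v w = g.density z ^ 2 * inner ℝ v w := rfl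

theorem form_bounded (z : ℂ) : Bornology.IsVonNBounded ℝ {v : ℂ | g.form z v v < 1} := by
  have h0 := g.density_pos z
  refine (NormedSpace.isVonNBounded_ball ℝ ℂ (1 / g.density z)).subset fun v hv => ?_
  simp only [Set.mem_ofPred_eq, form_apply, real_inner_self_eq_norm_sq] at hv
  rw [mem_ball_zero_iff, lt_div_iff₀ h0]
  nlinarith [norm_nonneg v, mul_nonneg (norm_nonneg v) h0.le]

theorem form_continuous_plane : Continuous fun z : ℂ ↦
    TotalSpace.mk' (ℂ →L[ℝ] ℂ →L[ℝ] ℝ)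
      (E := fun z : ℂ ↦ TangentSpace 𝓘(ℝ, ℂ) z →L[ℝ] TangentSpace 𝓘(ℝ, ℂ) z →L[ℝ] ℝ)
      z (g.form z) := by
  rw [continuous_iff_continuousAt]
  intro x
  rw [FiberBundle.continuousAt_totalSpace]
  refine ⟨continuousAt_id, ?_⟩
  have hc : Continuous g.form := (g.continuous_density.pow 2).smul continuous_const
  convert! hc.continuousAt (x := x) with z
  ext v w
  have hsymm : ∀ u : ℂ,
      (trivializationAt ℂ (TangentSpace 𝓘(ℝ, ℂ) (M := ℂ)) x).symm z u = u := fun u ↦ by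
    rw [← Trivialization.symmL_apply (R := ℝ) _ (by simp [chartAt_self_eq]),
      TangentBundle.symmL_model_space]
    rfl
  rw [hom_trivializationAt_apply]
  refine (inCoordinates_apply_eq₂ (F₃ := ℝ) (E₃ := Bundle.Trivial ℂ ℝ) (by simp [chartAt_self_eq])
    (by simp [chartAt_self_eq]) (by simp)).trans ?_
  have h1 : (Trivialization.linearMapAt ℝ (trivializationAt ℝ (Bundle.Trivial ℂ ℝ) x) z) =
      LinearMap.id := by ext; simp
  exact (LinearMap.congr_fun h1 _).trans
    (congrArg₂ (fun a b : ℂ ↦ g.form z a b) (hsymm v) (hsymm w))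

theorem form_continuous : Continuous fun p : g.Surface ↦
    TotalSpace.mk' (ℂ →L[ℝ] ℂ →L[ℝ] ℝ)
      (E := fun p : g.Surface ↦
        TangentSpace 𝓘(ℝ, ℂ) p →L[ℝ] TangentSpace 𝓘(ℝ, ℂ) p →L[ℝ] ℝ)
      p (g.form (g.coord p)) :=
  g.form_continuous_plane

/-- The Riemannian metric: the inner product at `p` is `ρ(p)²` times the Euclidean one, so that a
tangent vector `v` at `p` has length `ρ(p) |v|`. -/
def riemannianMetric :
    ContinuousRiemannianMetric ℂ (fun p : g.Surface ↦ TangentSpace 𝓘(ℝ, ℂ) p) where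
  inner p := g.form (g.coord p)
  symm p v w := by
    exact congrArg (g.density (g.coord p) ^ 2 * ·) (real_inner_comm (F := ℂ) w v)
  pos p v hv := mul_pos (pow_pos (g.density_pos _) 2) (real_inner_self_pos (F := ℂ).2 hv)
  isVonNBounded p := g.form_bounded (g.coord p)
  continuous := g.form_continuous

instance : RiemannianBundle (fun p : g.Surface ↦ TangentSpace 𝓘(ℝ, ℂ) p) :=
  ⟨g.riemannianMetric.toRiemannianMetric⟩

theorem norm_tangent (p : g.Surface) (v : TangentSpace 𝓘(ℝ, ℂ) p) :
    ‖v‖ = g.density (g.coord p) * ‖(show ℂ from v)‖ := by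
  rw [norm_eq_sqrt_real_inner]
  have : inner ℝ v v = (g.density (g.coord p) * ‖(show ℂ from v)‖) ^ 2 := by
    rw [mul_pow, ← real_inner_self_eq_norm_sq (F := ℂ)]
    rfl
  rw [this, Real.sqrt_sq]
  exact mul_nonneg (g.density_pos _).le (norm_nonneg _)

/-- The distance of the surface: the infimum of the lengths of the `C¹` curves joining two points.
It is finite and induces the topology of the plane. -/
instance : MetricSpace g.Surface :=
  letI : EMetricSpace g.Surface := EMetricSpace.ofRiemannianMetric 𝓘(ℝ, ℂ) g.Surface
  EMetricSpace.toMetricSpace fun x y => by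
    have h : Metric.eball y ⊤ = univ :=
      IsClopen.eq_univ ⟨Metric.isClosed_eball_top, Metric.isOpen_eball⟩
        ⟨y, Metric.mem_eball_self (by simp)⟩
    have hx : x ∈ Metric.eball y ⊤ := h ▸ mem_univ x
    exact (Metric.mem_eball.1 hx).ne

instance : IsRiemannianManifold 𝓘(ℝ, ℂ) g.Surface := ⟨fun _ _ => rfl⟩

/-- The area measure `ρ² dx dy`. -/
def area : Measure g.Surface :=
  (volume : Measure ℂ).withDensity fun z => ENNReal.ofReal (g.density z ^ 2)

/-- `D(a, r)`, the open disc of radius `r` for the distance of the surface, centred at the point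
with coordinate `a`. -/
def disc (a : ℂ) (r : ℝ) : Set g.Surface := Metric.ball (g.pt a) r

/-- `ωpos - ωneg` is the Jordan decomposition of the curvature measure of the surface with line
element `ρ |dz|`, that is, of the locally finite signed measure `-Δ (log ρ)`, where `Δ` is the
Laplacian in the sense of distributions. -/
def IsCurvatureMeasure (ωpos ωneg : Measure g.Surface) : Prop :=
  IsLocallyFiniteMeasure ωpos ∧ IsLocallyFiniteMeasure ωneg ∧ ωpos ⟂ₘ ωneg ∧
    ∀ φ : ℂ → ℝ, ContDiff ℝ ∞ φ → HasCompactSupport φ →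
      ∫ p, φ (g.coord p) ∂ωpos - ∫ p, φ (g.coord p) ∂ωneg =
        - ∫ z : ℂ, Real.log (g.density z) * Laplacian.laplacian φ z

/-- The surface has bounded curvature in the sense of Aleksandrov: in the isothermal coordinate
`z`, the distributional Laplacian of `log ρ` is a locally finite signed measure (so that `log ρ` is
locally a difference of two subharmonic functions). -/
def IsAleksandrov : Prop := ∃ ωpos ωneg : Measure g.Surface, g.IsCurvatureMeasure ωpos ωneg

/-- The surface is of parabolic type: it is conformally equivalent to the Euclidean plane, i.e. there is a diffeomorphism from `ℂ` whose differential multiplies the length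
of tangent vectors at each point by a positive factor depending only on the point. -/
def IsParabolic : Prop :=
  ∃ F : Diffeomorph 𝓘(ℝ, ℂ) 𝓘(ℝ, ℂ) ℂ g.Surface 1, ∀ z : ℂ, ∃ c : ℝ, 0 < c ∧
    ∀ v : TangentSpace 𝓘(ℝ, ℂ) z, ‖mfderiv 𝓘(ℝ, ℂ) 𝓘(ℝ, ℂ) F z v‖ = c * ‖v‖

end ConformalMetric

/-- The metric `|dz| / y` on `y ≥ 1` and `exp (1 - y) |dz|` on `y < 1`, where `z = x + i y`. -/
def metricY : ConformalMetric where
  density z := if 1 ≤ z.im then 1 / z.im else Real.exp (1 - z.im)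
  continuous_density := by
    refine continuous_if_le continuous_const Complex.continuous_im ?_ (by fun_prop) ?_
    · refine ContinuousOn.div continuousOn_const Complex.continuous_im.continuousOn fun z hz => ?_
      have : (1 : ℝ) ≤ z.im := hz
      linarith
    · intro z hz
      simp [← hz]
  density_pos z := by
    split_ifs with h
    · exact one_div_pos.2 (by linarith)
    · exact Real.exp_pos _

/-- The part `P = {y ≥ 1}` of the surface. -/
def regionP : Set metricY.Surface := {p | 1 ≤ (metricY.coord p).im}

/-- The part `Q = {y < 1}` of the surface. -/
def regionQ : Set metricY.Surface := {p | (metricY.coord p).im < 1}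

end

/-! Curvature. `log ρ` is `-log y` on P and `1 - y` on Q, and the two formulas have the same value
and the same first derivative at `y = 1`. Its distributional Laplacian therefore puts no mass on
that line: it is `1 / y ^ 2 = ρ ^ 2` on P and `0` on Q (`integral_log_density_mul_laplacian`,
`isCurvatureMeasure_iff`).

Since P carries curvature `-1` and Q carries none, the inequality of item 3 says that the area of `Q
∩ D(i, r)` is at most a constant times that of `P ∩ D(i, r)`. Distances are bounded below by
functions whose gradient is at most `ρ` (`sub_le_dist`) and above by explicit curves. The main such
function is `calibration`. With `R = exp (1 - y)` it gives `x ^ 2 ≤ 2 * exp r * y` on the P part of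
the disc and `x ^ 2 ≤ 2 * exp (r + 1 - R)` on the Q part. At each height the disc is thus at most
`exp (r / 2)` times a factor wide, and this factor is integrable against `ρ ^ 2`, so both areas are
`O(exp (r / 2))`.

Conversely, climbing to height `exp s`, crossing there and descending costs about `2 * s`, so the
disc contains a box around the line `y = 1` of width comparable to `exp (r / 2)`. For small `r`,
both areas are compared with `r ^ 2`.

The lower bounds for the distance also confine each closed ball to a compact box, whence
completeness. Parabolicity holds because the coordinate is itself conformal. -/

namespace ConformalMetric

variable (g : ConformalMetric)

/-! ### Bounds for the distance of a conformal metric. -/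

theorem edist_eq_riemannianEDist (p q : g.Surface) :
    edist p q = riemannianEDist 𝓘(ℝ, ℂ) p q := rfl

theorem enorm_mfderiv_curve {γ : ℝ → g.Surface} (t : ℝ) :
    ‖mfderiv 𝓘(ℝ, ℝ) 𝓘(ℝ, ℂ) γ t 1‖ₑ =
      ENNReal.ofReal (g.density (g.coord (γ t)) * ‖deriv (fun s => g.coord (γ s)) t‖) := by
  rw [← ofReal_norm, norm_tangent]
  congr 3
  have : mfderiv 𝓘(ℝ, ℝ) 𝓘(ℝ, ℂ) (fun s => g.coord (γ s)) t
    = fderiv ℝ (fun s => g.coord (γ s)) t := mfderiv_eq_fderiv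
  exact (DFunLike.congr_fun this (1 : ℝ)).trans (fderiv_apply_one_eq_deriv)

theorem pathELength_eq (γ : ℝ → g.Surface) (a b : ℝ) :
    pathELength 𝓘(ℝ, ℂ) γ a b = ∫⁻ t in Icc a b,
      ENNReal.ofReal (g.density (g.coord (γ t)) * ‖deriv (fun s => g.coord (γ s)) t‖) := by
  rw [pathELength_eq_lintegral_mfderiv_Icc]
  exact lintegral_congr fun t => g.enorm_mfderiv_curve t

theorem dist_le_of_speed_le {γ : ℝ → ℂ} (hγ : ContDiff ℝ 1 γ) {a b M : ℝ} (hab : a ≤ b)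
    (hM : ∀ t ∈ Icc a b, g.density (γ t) * ‖deriv γ t‖ ≤ M) :
    dist (g.pt (γ a)) (g.pt (γ b)) ≤ M * (b - a) := by
  have hM0 : 0 ≤ M := (mul_nonneg (g.density_pos _).le (norm_nonneg _)).trans
    (hM a (left_mem_Icc.2 hab))
  rw [dist_edist]
  refine ENNReal.toReal_le_of_le_ofReal (by nlinarith) ?_
  have hm : ContMDiffOn 𝓘(ℝ, ℝ) 𝓘(ℝ, ℂ) 1 (fun t => g.pt (γ t)) (Icc a b) :=
    hγ.contMDiff.contMDiffOn
  refine (riemannianEDist_le_pathELength hm rfl rfl hab).trans ?_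
  refine (g.pathELength_eq (fun t => g.pt (γ t)) a b).trans_le ?_
  calc _ ≤ ∫⁻ t in Icc a b, ENNReal.ofReal M :=
        setLIntegral_mono measurable_const fun t ht => ENNReal.ofReal_le_ofReal (hM t ht)
    _ = _ := by rw [setLIntegral_const, Real.volume_Icc, ENNReal.ofReal_mul hM0]

/-- Along a curve of length less than `r`, the derivative of `f` is at most the speed, so `f`
increases by less than `r`. This is the source of every lower bound for the distance. -/
theorem sub_le_dist {f : ℂ → ℝ} {f' : ℂ → ℂ →L[ℝ] ℝ} (hf : ∀ z, HasFDerivAt f (f' z) z)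
    (hb : ∀ z v, f' z v ≤ g.density z * ‖v‖) (z w : ℂ) :
    f w - f z ≤ dist (g.pt z) (g.pt w) := by
  refine le_of_forall_gt fun r hr => ?_
  have hr0 : 0 ≤ r := dist_nonneg.trans hr.le
  have hr' : riemannianEDist 𝓘(ℝ, ℂ) (g.pt z) (g.pt w) < ENNReal.ofReal r := by
    rw [← edist_eq_riemannianEDist, edist_dist]
    exact (ENNReal.ofReal_lt_ofReal_iff_of_nonneg dist_nonneg).2 hr
  obtain ⟨γ, h0, h1, hγ, hl, -⟩ := exists_lt_locally_constant_of_riemannianEDist_lt hr' zero_lt_one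
  have hc : ContDiff ℝ 1 fun s => g.coord (γ s) := by
    have : ContMDiff 𝓘(ℝ, ℝ) 𝓘(ℝ, ℂ) 1 (fun s => g.coord (γ s)) := hγ
    exact contMDiff_iff_contDiff.1 this
  rw [g.pathELength_eq] at hl
  set φ : ℝ → ℝ := fun t => g.density (g.coord (γ t)) * ‖deriv (fun s => g.coord (γ s)) t‖
  have hφ : Continuous φ :=
    (g.continuous_density.comp hc.continuous).mul (hc.continuous_deriv le_rfl).norm
  rw [← ofReal_integral_eq_lintegral_ofReal (hφ.continuousOn.integrableOn_Icc)
    (.of_forall fun t => mul_nonneg (g.density_pos _).le (norm_nonneg _))] at hl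
  have hl' := (ENNReal.ofReal_lt_ofReal_iff_of_nonneg
    (integral_nonneg fun t => mul_nonneg (g.density_pos _).le (norm_nonneg _))).1 hl
  refine lt_of_le_of_lt ?_ hl'
  have hd : ∀ t, HasDerivAt (fun s => f (g.coord (γ s)))
      (f' (g.coord (γ t)) (deriv (fun s => g.coord (γ s)) t)) t := fun t =>
    (hf _).comp_hasDerivAt t (hc.differentiable one_ne_zero t).hasDerivAt
  have key := intervalIntegral.sub_le_integral_of_hasDeriv_right_of_le (zero_le_one' ℝ)
    (continuous_iff_continuousAt.2 fun t => (hd t).continuousAt).continuousOn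
    (fun t _ => (hd t).hasDerivWithinAt) (hφ.continuousOn.integrableOn_Icc) (fun t _ => hb _ _)
  rw [intervalIntegral.integral_of_le zero_le_one, ← integral_Icc_eq_integral_Ioc] at key
  rw [h0, h1] at key
  exact key

end ConformalMetric

/-- All functions of the height used below are glued at `y = 1` from two formulas with matching
values and slopes. They are then differentiable everywhere, as `sub_le_dist` requires. -/
theorem hasDerivAt_ite_one_le {a b a' b' : ℝ → ℝ} (ha : ∀ x, 1 ≤ x → HasDerivAt a (a' x) x)
    (hb : ∀ x, x ≤ 1 → HasDerivAt b (b' x) x) (h : a 1 = b 1) (h' : a' 1 = b' 1) (x : ℝ) :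
    HasDerivAt (fun y => if 1 ≤ y then a y else b y) (if 1 ≤ x then a' x else b' x) x := by
  rcases lt_trichotomy x 1 with hx | rfl | hx
  · rw [if_neg (not_le.2 hx)]
    refine (hb x hx.le).congr_of_eventuallyEq ?_
    filter_upwards [Iio_mem_nhds hx] with y hy
    exact if_neg (not_le.2 hy)
  · rw [if_pos le_rfl, ← hasDerivWithinAt_univ, ← Iic_union_Ici (a := (1 : ℝ))]
    refine HasDerivWithinAt.union ?_ ?_
    · rw [h']
      refine (hb 1 le_rfl).hasDerivWithinAt.congr (fun y (hy : y ≤ 1) => ?_) (by simp [h])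
      rcases hy.eq_or_lt with rfl | hy
      · simp [h]
      · exact if_neg (not_le.2 hy)
    · exact (ha 1 le_rfl).hasDerivWithinAt.congr (fun y hy => if_pos hy) (by simp)
  · rw [if_pos hx.le]
    refine (ha x hx.le).congr_of_eventuallyEq ?_
    filter_upwards [Ioi_mem_nhds hx] with y hy
    exact if_pos (le_of_lt hy)

theorem re_im_combination_le {p q ρ : ℝ} (hρ : 0 ≤ ρ) (h : p ^ 2 + q ^ 2 ≤ ρ ^ 2) (v : ℂ) :
    p * v.re + q * v.im ≤ ρ * ‖v‖ := by
  refine le_of_sq_le_sq ?_ (by positivity)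
  rw [mul_pow, Complex.sq_norm, Complex.normSq_apply]
  nlinarith [sq_nonneg (p * v.im - q * v.re), mul_le_mul_of_nonneg_right h
    (add_nonneg (mul_self_nonneg v.re) (mul_self_nonneg v.im))]

/-! ### Functions of slope at most one on Y. -/

namespace metricY

/-- The density of `metricY` as a function of the height. -/
noncomputable def profile (y : ℝ) : ℝ := if 1 ≤ y then 1 / y else Real.exp (1 - y)

theorem density_eq (z : ℂ) : metricY.density z = profile z.im := rfl

theorem profile_of_one_le {y : ℝ} (h : 1 ≤ y) : profile y = 1 / y := if_pos h

theorem profile_of_lt_one {y : ℝ} (h : y < 1) : profile y = Real.exp (1 - y) :=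
  if_neg (not_le.2 h)

theorem profile_pos (y : ℝ) : 0 < profile y := metricY.density_pos ⟨0, y⟩

theorem hasDerivAt_profile (y : ℝ) :
    HasDerivAt profile (if 1 ≤ y then -1 / y ^ 2 else -Real.exp (1 - y)) y := by
  refine hasDerivAt_ite_one_le (a := fun y => 1 / y) (a' := fun y => -1 / y ^ 2)
    (b := fun y => Real.exp (1 - y)) (b' := fun y => -Real.exp (1 - y))
    (fun x hx => ?_) (fun x _ => ?_) (by simp) (by simp) y
  · simpa [neg_div] using (hasDerivAt_inv (by linarith : x ≠ 0))
  · simpa using ((hasDerivAt_id x).const_sub 1).exp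

theorem continuous_profile : Continuous profile :=
  continuous_iff_continuousAt.2 fun y => (hasDerivAt_profile y).continuousAt

theorem sub_le_dist_of_partials {f : ℂ → ℝ} {p q : ℂ → ℝ}
    (hf : ∀ z, HasFDerivAt f (p z • Complex.reCLM + q z • Complex.imCLM) z)
    (hb : ∀ z, p z ^ 2 + q z ^ 2 ≤ profile z.im ^ 2) (z w : ℂ) :
    f w - f z ≤ dist (metricY.pt z) (metricY.pt w) :=
  metricY.sub_le_dist hf (fun z v => by
    simpa [density_eq] using re_im_combination_le (profile_pos z.im).le (hb z) v) z w

theorem hasFDerivAt_comp_im {u : ℝ → ℝ} {u' : ℝ} {z : ℂ} (h : HasDerivAt u u' z.im) :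
    HasFDerivAt (fun z : ℂ => u z.im) (u' • Complex.imCLM) z :=
  HasDerivAt.comp_hasFDerivAt z h Complex.imCLM.hasFDerivAt

theorem hasFDerivAt_comp_re {u : ℝ → ℝ} {u' : ℝ} {z : ℂ} (h : HasDerivAt u u' z.re) :
    HasFDerivAt (fun z : ℂ => u z.re) (u' • Complex.reCLM) z :=
  HasDerivAt.comp_hasFDerivAt z h Complex.reCLM.hasFDerivAt

/-- A primitive of `-profile`. -/
noncomputable def depth (y : ℝ) : ℝ := if 1 ≤ y then -Real.log y else Real.exp (1 - y) - 1

theorem hasDerivAt_depth (y : ℝ) : HasDerivAt depth (-profile y) y := by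
  have := hasDerivAt_ite_one_le (a := fun y => -Real.log y) (b := fun y => Real.exp (1 - y) - 1)
    (a' := fun y => -(1 / y)) (b' := fun y => -Real.exp (1 - y))
    (fun x hx => ?_) (fun x _ => ?_) (by simp) (by simp) y
  · have h : (if 1 ≤ y then -(1 / y) else -Real.exp (1 - y)) = -profile y := by
      unfold profile
      split_ifs <;> rfl
    exact h ▸ this
  · rw [one_div]
    exact (Real.hasDerivAt_log (by linarith : x ≠ 0)).fun_neg
  · simpa using (((hasDerivAt_id x).const_sub 1).exp).sub_const 1

/-- The gradient of `depth` has length exactly `ρ`. This controls how far down a disc reaches. -/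
theorem depth_le_dist (z : ℂ) : depth z.im ≤ dist (metricY.pt Complex.I) (metricY.pt z) := by
  have := sub_le_dist_of_partials (f := fun z => depth z.im) (p := fun _ => 0)
    (q := fun z => -profile z.im)
    (fun z => by simpa using hasFDerivAt_comp_im (hasDerivAt_depth z.im))
    (fun z => by simp) Complex.I z
  simpa [depth] using this

/-- The summand depending on the height in the horofunction-like `calibration`. -/
noncomputable def spread (y : ℝ) : ℝ := if 1 ≤ y then y ^ 2 + 1 else 2 * Real.exp (y - 1)

theorem spread_pos (y : ℝ) : 0 < spread y := by
  unfold spread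
  split_ifs <;> positivity

theorem hasDerivAt_spread (y : ℝ) :
    HasDerivAt spread (if 1 ≤ y then 2 * y else 2 * Real.exp (y - 1)) y := by
  refine hasDerivAt_ite_one_le (a := fun y => y ^ 2 + 1) (a' := fun y => 2 * y)
    (b := fun y => 2 * Real.exp (y - 1)) (b' := fun y => 2 * Real.exp (y - 1))
    (fun x hx => ?_) (fun x _ => ?_) (by norm_num) (by simp) y
  · simpa using ((hasDerivAt_id x).pow 2).add_const 1
  · simpa using (((hasDerivAt_id x).sub_const 1).exp).const_mul 2

/-- A function with slope at most `1` for the metric of `Y`, equal to `log (2 cosh d(i, ·))` on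
`P` and to the distance from `i` up to a bounded error on `Q`. -/
noncomputable def calibration (z : ℂ) : ℝ := Real.log (z.re ^ 2 + spread z.im) + depth z.im

theorem calibration_le_dist (z : ℂ) :
    calibration z ≤ Real.log 2 + dist (metricY.pt Complex.I) (metricY.pt z) := by
  have hpos : ∀ z : ℂ, 0 < z.re ^ 2 + spread z.im := fun z =>
    add_pos_of_nonneg_of_pos (sq_nonneg _) (spread_pos _)
  have := sub_le_dist_of_partials (f := calibration)
    (p := fun z => 2 * z.re / (z.re ^ 2 + spread z.im))
    (q := fun z => (if 1 ≤ z.im then 2 * z.im else 2 * Real.exp (z.im - 1)) /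
      (z.re ^ 2 + spread z.im) - profile z.im) (fun z => ?_) (fun z => ?_) Complex.I z
  · have hI : calibration Complex.I = Real.log 2 := by
      simp [calibration, spread, depth]; norm_num
    linarith
  · have h1 : HasFDerivAt (fun z : ℂ => z.re ^ 2) ((2 * z.re) • Complex.reCLM) z :=
      hasFDerivAt_comp_re (by simpa using (hasDerivAt_id z.re).pow 2)
    have h3 := hasDerivAt_spread z.im
    generalize (if 1 ≤ z.im then 2 * z.im else 2 * Real.exp (z.im - 1)) = s' at h3 ⊢
    have h2 := ((h1.add (hasFDerivAt_comp_im h3)).log (hpos z).ne').add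
      (hasFDerivAt_comp_im (hasDerivAt_depth z.im))
    refine h2.congr_fderiv ?_
    ext v
    simp
    ring
  · have hS := hpos z
    by_cases h : 1 ≤ z.im
    · have hs : spread z.im = z.im ^ 2 + 1 := if_pos h
      rw [hs] at hS ⊢
      simp only [if_pos h, profile_of_one_le h]
      have hy : 0 < z.im := by linarith
      -- The squared gradient falls short of `ρ ^ 2` by an explicit nonnegative term.
      have : (2 * z.re / (z.re ^ 2 + (z.im ^ 2 + 1))) ^ 2 +
          (2 * z.im / (z.re ^ 2 + (z.im ^ 2 + 1)) - 1 / z.im) ^ 2 =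
          (1 / z.im) ^ 2 - 4 / (z.re ^ 2 + (z.im ^ 2 + 1)) ^ 2 := by
        field_simp
        ring
      rw [this]
      have : 0 ≤ 4 / (z.re ^ 2 + (z.im ^ 2 + 1)) ^ 2 := by positivity
      linarith
    · have hs : spread z.im = 2 * Real.exp (z.im - 1) := if_neg h
      rw [hs] at hS ⊢
      simp only [if_neg h, profile_of_lt_one (not_le.1 h)]
      have hR : Real.exp (1 - z.im) = (Real.exp (z.im - 1))⁻¹ := by
        rw [← Real.exp_neg]; congr 1; ring
      -- With `E = exp (y - 1)`, the deficit in the squared gradient has numerator `8 * E - 4 * E ^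
      -- 2`, which is nonnegative because `E ≤ 1`.
      have hE : Real.exp (z.im - 1) ≤ 1 := Real.exp_le_one_iff.2 (by linarith [not_le.1 h])
      have hE0 := Real.exp_pos (z.im - 1)
      rw [hR]
      generalize Real.exp (z.im - 1) = E at *
      have : (2 * z.re / (z.re ^ 2 + 2 * E)) ^ 2 + (2 * E / (z.re ^ 2 + 2 * E) - E⁻¹) ^ 2 =
          E⁻¹ ^ 2 - (8 * E - 4 * E ^ 2) / (z.re ^ 2 + 2 * E) ^ 2 := by
        field_simp
        ring
      rw [this]
      have : 0 ≤ (8 * E - 4 * E ^ 2) / (z.re ^ 2 + 2 * E) ^ 2 :=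
        div_nonneg (by nlinarith) (by positivity)
      linarith

theorem exp_calibration_le {r : ℝ} {z : ℂ}
    (h : dist (metricY.pt Complex.I) (metricY.pt z) ≤ r) :
    (z.re ^ 2 + spread z.im) * Real.exp (depth z.im) ≤ 2 * Real.exp r := by
  have hpos : 0 < z.re ^ 2 + spread z.im :=
    add_pos_of_nonneg_of_pos (sq_nonneg _) (spread_pos _)
  have := Real.exp_le_exp.2 ((calibration_le_dist z).trans (by gcongr : _ ≤ Real.log 2 + r))
  rwa [calibration, Real.exp_add, Real.exp_add, Real.exp_log hpos, Real.exp_log two_pos] at this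

theorem sq_add_sq_le_of_one_le {r : ℝ} {z : ℂ} (hz : 1 ≤ z.im)
    (h : dist (metricY.pt Complex.I) (metricY.pt z) ≤ r) :
    z.re ^ 2 + z.im ^ 2 + 1 ≤ 2 * Real.exp r * z.im := by
  have := exp_calibration_le h
  have hy : 0 < z.im := by linarith
  rw [spread, depth, if_pos hz, if_pos hz, Real.exp_neg, Real.exp_log hy,
    ← div_eq_mul_inv, div_le_iff₀ hy] at this
  linarith

theorem sq_mul_exp_le_of_lt_one {r : ℝ} {z : ℂ} (hz : z.im < 1)
    (h : dist (metricY.pt Complex.I) (metricY.pt z) ≤ r) :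
    (z.re ^ 2 + 2 * Real.exp (z.im - 1)) * Real.exp (Real.exp (1 - z.im) - 1) ≤
      2 * Real.exp r := by
  have := exp_calibration_le h
  rwa [spread, depth, if_neg (not_le.2 hz), if_neg (not_le.2 hz)] at this

/-- For small `r` the calibration only gives `|x| = O(√r)`, too weak for an area of order `r ^ 2`;
this bound is linear in `r`. With `u = x * ρ(y)` and `|ρ'| ≤ ρ ^ 2`, the squared gradient of `u` is
at most `ρ ^ 2 * (1 + u ^ 2)`, and `arsinh` cancels the last factor. The factor 2 is slack. -/
theorem arsinh_le_dist (z : ℂ) :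
    |Real.arsinh (z.re * profile z.im)| ≤
      2 * dist (metricY.pt Complex.I) (metricY.pt z) := by
  set h : ℂ → ℝ := fun z => Real.arsinh (z.re * profile z.im) / 2
  set p' : ℝ → ℝ := fun y => if 1 ≤ y then -1 / y ^ 2 else -Real.exp (1 - y)
  set c : ℂ → ℝ := fun z => (√(1 + (z.re * profile z.im) ^ 2))⁻¹ / 2
  have hd : ∀ z, HasFDerivAt h ((c z * profile z.im) • Complex.reCLM +
      (c z * (z.re * p' z.im)) • Complex.imCLM) z := fun z => by
    have h1 : HasFDerivAt (fun z : ℂ => z.re * profile z.im)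
        (z.re • (p' z.im • Complex.imCLM) + profile z.im • Complex.reCLM) z :=
      Complex.reCLM.hasFDerivAt.mul (hasFDerivAt_comp_im (hasDerivAt_profile z.im))
    have h2 := ((Real.hasDerivAt_arsinh (z.re * profile z.im)).div_const 2).comp_hasFDerivAt z h1
    refine h2.congr_fderiv ?_
    ext v
    simp [c]
    ring
  have hb : ∀ z, (c z * profile z.im) ^ 2 + (c z * (z.re * p' z.im)) ^ 2 ≤ profile z.im ^ 2 := by
    intro z
    have hp := profile_pos z.im
    have hp' : p' z.im ^ 2 ≤ profile z.im ^ 4 := by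
      by_cases hz : 1 ≤ z.im
      · simp only [p', if_pos hz, profile_of_one_le hz]
        exact le_of_eq (by ring)
      · simp only [p', if_neg hz, profile_of_lt_one (not_le.1 hz)]
        rw [neg_sq]
        exact pow_le_pow_right₀ (Real.one_le_exp (by linarith [not_le.1 hz])) (by norm_num)
    have hc : c z ^ 2 * (1 + (z.re * profile z.im) ^ 2) = 1 / 4 := by
      have : 0 < 1 + (z.re * profile z.im) ^ 2 := by positivity
      simp only [c]
      rw [div_pow, inv_pow, Real.sq_sqrt this.le]
      field_simp
      norm_num
    have : c z ^ 2 * z.re ^ 2 * p' z.im ^ 2 ≤ c z ^ 2 * z.re ^ 2 * profile z.im ^ 4 :=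
      mul_le_mul_of_nonneg_left hp' (by positivity)
    have h4 : (c z * profile z.im) ^ 2 + c z ^ 2 * z.re ^ 2 * profile z.im ^ 4 =
      profile z.im ^ 2 * (1 / 4) := by rw [← hc]; ring
    nlinarith [sq_nonneg (profile z.im)]
  have h1 := sub_le_dist_of_partials hd hb Complex.I z
  have h2 := sub_le_dist_of_partials hd hb z Complex.I
  rw [dist_comm] at h2
  have hI : h Complex.I = 0 := by simp [h]
  rw [hI] at h1 h2
  simp only [h] at h1 h2
  rw [abs_le]
  constructor <;> linarith

end metricY

/-! ### Area by horizontal slices. -/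

theorem lintegral_complex_eq (F : ℂ → ℝ≥0∞) (hF : Measurable F) :
    ∫⁻ z, F z = ∫⁻ y : ℝ, ∫⁻ x : ℝ, F ⟨x, y⟩ := by
  rw [← (Complex.volume_preserving_equiv_real_prod.symm).lintegral_comp_emb
    Complex.measurableEquivRealProd.symm.measurableEmbedding, Measure.volume_eq_prod,
    lintegral_prod_symm' (fun p => F (Complex.measurableEquivRealProd.symm p))
      (hF.comp Complex.measurableEquivRealProd.symm.measurable)]
  rfl

theorem volume_complex_rectangle (a b c d : ℝ) :
    volume {z : ℂ | z.re ∈ Icc a b ∧ z.im ∈ Icc c d} =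
      ENNReal.ofReal (b - a) * ENNReal.ofReal (d - c) := by
  have := Complex.volume_preserving_equiv_real_prod.measure_preimage_equiv
    (Icc a b ×ˢ Icc c d)
  rw [Measure.volume_eq_prod, Measure.prod_prod, Real.volume_Icc, Real.volume_Icc] at this
  exact this

namespace metricY

theorem area_apply {S : Set metricY.Surface} (hS : MeasurableSet S) :
    metricY.area S = ∫⁻ z in {z | metricY.pt z ∈ S}, ENNReal.ofReal (profile z.im ^ 2) :=
  withDensity_apply _ hS

theorem area_le {S : Set metricY.Surface} {J : Set ℝ} (hJ : MeasurableSet J) {w : ℝ → ℝ}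
    (hw : Measurable w)
    (hS : ∀ z, metricY.pt z ∈ S → z.im ∈ J ∧ |z.re| ≤ w z.im) :
    metricY.area S ≤ ∫⁻ y in J, ENNReal.ofReal (profile y ^ 2 * (2 * w y)) := by
  set T : Set ℂ := {z | z.im ∈ J ∧ |z.re| ≤ w z.im}
  have hT : MeasurableSet T := (Complex.measurable_im hJ).inter
    (measurableSet_le (measurable_abs.comp Complex.measurable_re) (hw.comp Complex.measurable_im))
  have hm : Measurable fun z : ℂ => ENNReal.ofReal (profile z.im ^ 2) :=
    ((continuous_profile.comp Complex.continuous_im).pow 2).measurable.ennreal_ofReal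
  calc metricY.area S ≤ metricY.area {p | metricY.coord p ∈ T} := measure_mono fun z hz => hS z hz
    _ = ∫⁻ z in T, ENNReal.ofReal (profile z.im ^ 2) := area_apply hT
    _ = ∫⁻ y : ℝ, ∫⁻ x : ℝ, T.indicator (fun z => ENNReal.ofReal (profile z.im ^ 2)) ⟨x, y⟩ := by
      rw [← lintegral_indicator hT, lintegral_complex_eq _ (hm.indicator hT)]
    _ ≤ ∫⁻ y, J.indicator (fun y => ENNReal.ofReal (profile y ^ 2 * (2 * w y))) y := by
      refine lintegral_mono fun y => ?_
      by_cases hy : y ∈ J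
      · rw [indicator_of_mem hy, ENNReal.ofReal_mul (sq_nonneg _)]
        calc _ ≤ ∫⁻ x : ℝ, (Icc (-w y) (w y)).indicator
              (fun _ => ENNReal.ofReal (profile y ^ 2)) x := by
              refine lintegral_mono fun x => ?_
              by_cases hx : (⟨x, y⟩ : ℂ) ∈ T
              · rw [indicator_of_mem hx, indicator_of_mem (show x ∈ Icc (-w y) (w y) from abs_le.1 hx.2)]
              · rw [indicator_of_notMem hx]
                exact zero_le
          _ = _ := by
              rw [lintegral_indicator measurableSet_Icc, setLIntegral_const, Real.volume_Icc]
              congr 2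
              ring
      · have : ∀ x : ℝ, (⟨x, y⟩ : ℂ) ∉ T := fun x hx => hy hx.1
        simp [this]
    _ = _ := lintegral_indicator hJ _

theorem le_area {S : Set metricY.Surface} {a b c d k : ℝ} (hk : 0 ≤ k)
    (hS : ∀ z : ℂ, z.re ∈ Icc a b → z.im ∈ Icc c d → metricY.pt z ∈ S ∧ k ≤ profile z.im ^ 2)
    (hab : a ≤ b) :
    ENNReal.ofReal (k * ((b - a) * (d - c))) ≤ metricY.area S := by
  set T : Set ℂ := {z | z.re ∈ Icc a b ∧ z.im ∈ Icc c d}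
  have hT : MeasurableSet T := (Complex.measurable_re measurableSet_Icc).inter
    (Complex.measurable_im measurableSet_Icc)
  have hm : Measurable fun z : ℂ => ENNReal.ofReal (profile z.im ^ 2) :=
    ((continuous_profile.comp Complex.continuous_im).pow 2).measurable.ennreal_ofReal
  calc _ = ∫⁻ z in T, ENNReal.ofReal k := by
        rw [setLIntegral_const, volume_complex_rectangle, ENNReal.ofReal_mul hk,
          ENNReal.ofReal_mul (sub_nonneg.2 hab)]
    _ ≤ ∫⁻ z in T, ENNReal.ofReal (profile z.im ^ 2) :=
        setLIntegral_mono hm fun z hz => ENNReal.ofReal_le_ofReal (hS z hz.1 hz.2).2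
    _ = metricY.area {p | metricY.coord p ∈ T} := (area_apply hT).symm
    _ ≤ metricY.area S := measure_mono fun z hz => (hS z hz.1 hz.2).1

/-! ### Explicit curves and upper bounds for the distance. -/

theorem hasDerivAt_mk {a b : ℝ → ℝ} {a' b' t : ℝ} (ha : HasDerivAt a a' t)
    (hb : HasDerivAt b b' t) : HasDerivAt (fun t => (⟨a t, b t⟩ : ℂ)) ⟨a', b'⟩ t := by
  have := ha.ofReal_comp.add (hb.ofReal_comp.mul_const Complex.I)
  rw [show (⟨a', b'⟩ : ℂ) = a' + b' * Complex.I from Complex.mk_eq_add_mul_I _ _]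
  exact this.congr_of_eventuallyEq (.of_forall fun t => Complex.mk_eq_add_mul_I _ _)

theorem contDiff_mk {a b : ℝ → ℝ} (ha : ContDiff ℝ 1 a) (hb : ContDiff ℝ 1 b) :
    ContDiff ℝ 1 (fun t => (⟨a t, b t⟩ : ℂ)) :=
  Complex.equivRealProdCLM.symm.contDiff.comp (ha.prodMk hb)

theorem dist_horizontal_le {a b : ℝ} (hab : a ≤ b) (y : ℝ) :
    dist (metricY.pt ⟨a, y⟩) (metricY.pt ⟨b, y⟩) ≤ profile y * (b - a) := by
  refine metricY.dist_le_of_speed_le (γ := fun t => ⟨t, y⟩) (contDiff_mk contDiff_id contDiff_const)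
    hab fun t _ => ?_
  rw [(hasDerivAt_mk (hasDerivAt_id' t) (hasDerivAt_const t y)).deriv, density_eq]
  have : ‖(⟨1, 0⟩ : ℂ)‖ = 1 := norm_one
  rw [this, mul_one]

theorem dist_vertical_le {y y' M : ℝ} (h : y ≤ y') (hM : ∀ t ∈ Icc y y', profile t ≤ M) (x : ℝ) :
    dist (metricY.pt ⟨x, y⟩) (metricY.pt ⟨x, y'⟩) ≤ M * (y' - y) := by
  refine metricY.dist_le_of_speed_le (γ := fun t => ⟨x, t⟩) (contDiff_mk contDiff_const contDiff_id)
    h fun t ht => ?_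
  rw [(hasDerivAt_mk (hasDerivAt_const t x) (hasDerivAt_id' t)).deriv, density_eq]
  have : ‖(⟨0, 1⟩ : ℂ)‖ = 1 := Complex.norm_I
  rw [this, mul_one]
  exact hM t ht

theorem dist_vertical_log_le {y : ℝ} (h : 1 ≤ y) (x : ℝ) :
    dist (metricY.pt ⟨x, 1⟩) (metricY.pt ⟨x, y⟩) ≤ Real.log y := by
  have := metricY.dist_le_of_speed_le (γ := fun t => ⟨x, Real.exp t⟩)
    (contDiff_mk contDiff_const Real.contDiff_exp) (Real.log_nonneg h) (M := 1) fun t ht => ?_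
  · simpa [Real.exp_log (by linarith : 0 < y)] using this
  · rw [(hasDerivAt_mk (hasDerivAt_const t x) (Real.hasDerivAt_exp t)).deriv, density_eq,
      profile_of_one_le (Real.one_le_exp ht.1)]
    have : ‖(⟨0, Real.exp t⟩ : ℂ)‖ = Real.exp t := by
      rw [show (⟨0, Real.exp t⟩ : ℂ) = (Real.exp t : ℝ) * Complex.I by
        rw [Complex.mk_eq_add_mul_I]; simp]
      rw [norm_mul, Complex.norm_I, mul_one, Complex.norm_real, Real.norm_of_nonneg
        (Real.exp_pos t).le]
    rw [this]
    simp

theorem profile_le_of_one_le {y : ℝ} (h : 1 ≤ y) : profile y ≤ 1 := by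
  rw [profile_of_one_le h, one_div]
  exact inv_le_one_of_one_le₀ h

theorem one_le_profile_of_le_one {y : ℝ} (h : y ≤ 1) : 1 ≤ profile y := by
  rcases h.eq_or_lt with rfl | h
  · simp [profile]
  · rw [profile_of_lt_one h]
    exact Real.one_le_exp (by linarith)

theorem profile_le_three {y : ℝ} (h : 0 ≤ y) : profile y ≤ 3 := by
  by_cases hy : 1 ≤ y
  · linarith [profile_le_of_one_le hy]
  · rw [profile_of_lt_one (not_le.1 hy)]
    exact (Real.exp_le_exp.2 (by linarith)).trans Real.exp_one_lt_three.le

theorem quarter_le_sq_profile {y : ℝ} (h : y ≤ 2) : 1 / 4 ≤ profile y ^ 2 := by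
  by_cases hy : 1 ≤ y
  · rw [profile_of_one_le hy, div_pow, one_pow]
    exact one_div_le_one_div_of_le (by positivity) (by nlinarith)
  · nlinarith [one_le_profile_of_le_one (not_le.1 hy).le]

theorem dist_level_one_le {x y : ℝ} (hy : 0 ≤ y) (hy' : y ≤ 2) :
    dist (metricY.pt ⟨x, 1⟩) (metricY.pt ⟨x, y⟩) ≤ 3 := by
  rcases le_total y 1 with h | h
  · rw [dist_comm]
    refine (dist_vertical_le h (fun t ht => profile_le_three (hy.trans ht.1)) x).trans ?_
    linarith
  · refine (dist_vertical_le h (fun t ht => profile_le_of_one_le ht.1) x).trans ?_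
    linarith

/-- The path climbs to height `exp s` (length `s`), crosses there (length at most 1, since the
density is `exp (-s)`), descends to height 1 (length `s`) and ends with a vertical piece of length
at most 3. -/
theorem dist_le_of_mem_box {x y s : ℝ} (hs : 0 ≤ s) (hx : x ∈ Icc 0 (Real.exp s))
    (hy : y ∈ Icc 0 2) : dist (metricY.pt Complex.I) (metricY.pt ⟨x, y⟩) ≤ 2 * s + 4 := by
  have h1 : 1 ≤ Real.exp s := Real.one_le_exp hs
  have hup := fun x => dist_vertical_log_le h1 x
  simp only [Real.log_exp] at hup
  have hh := dist_horizontal_le hx.1 (Real.exp s)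
  have hh' : profile (Real.exp s) * (x - 0) ≤ 1 := by
    rw [profile_of_one_le h1, sub_zero, one_div, inv_mul_le_iff₀ (Real.exp_pos s), mul_one]
    exact hx.2
  have hd := dist_comm (metricY.pt ⟨x, 1⟩) (metricY.pt ⟨x, Real.exp s⟩)
  have h3 := dist_level_one_le (x := x) hy.1 hy.2
  have t1 := dist_triangle (metricY.pt ⟨0, 1⟩) (metricY.pt ⟨0, Real.exp s⟩)
    (metricY.pt ⟨x, Real.exp s⟩)
  have t2 := dist_triangle (metricY.pt ⟨0, 1⟩) (metricY.pt ⟨x, Real.exp s⟩) (metricY.pt ⟨x, 1⟩)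
  have t3 := dist_triangle (metricY.pt ⟨0, 1⟩) (metricY.pt ⟨x, 1⟩) (metricY.pt ⟨x, y⟩)
  rw [show metricY.pt Complex.I = metricY.pt ⟨0, 1⟩ from rfl]
  linarith [hup 0, hup x]

theorem dist_le_add_of_one_le {x y : ℝ} (hx : 0 ≤ x) (hy : 1 ≤ y) :
    dist (metricY.pt Complex.I) (metricY.pt ⟨x, y⟩) ≤ x + (y - 1) := by
  have h1 := dist_horizontal_le hx 1
  have h2 := dist_vertical_le hy (fun t ht => profile_le_of_one_le ht.1) x
  have h3 := dist_triangle (metricY.pt ⟨0, 1⟩) (metricY.pt ⟨x, 1⟩) (metricY.pt ⟨x, y⟩)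
  rw [show metricY.pt Complex.I = metricY.pt ⟨0, 1⟩ from rfl]
  rw [show profile 1 = 1 by simp [profile]] at h1
  linarith

/-! ### Areas of the two parts of the disc. -/

theorem mem_disc_iff {z : ℂ} {r : ℝ} : metricY.pt z ∈ metricY.disc Complex.I r ↔
    dist (metricY.pt Complex.I) (metricY.pt z) < r := by
  rw [ConformalMetric.disc, Metric.mem_ball, dist_comm]

theorem pt_mem_regionP {z : ℂ} : metricY.pt z ∈ regionP ↔ 1 ≤ z.im := Iff.rfl

theorem pt_mem_regionQ {z : ℂ} : metricY.pt z ∈ regionQ ↔ z.im < 1 := Iff.rfl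

/-- The area of `P ∩ D(i, r)` is at most a constant multiple of `exp (r / 2)`. -/
theorem exists_area_regionP_inter_disc_le : ∃ C : ℝ, 0 < C ∧ ∀ r : ℝ,
    metricY.area (regionP ∩ metricY.disc Complex.I r) ≤ ENNReal.ofReal (C * Real.exp (r / 2)) := by
  have hint : IntegrableOn (fun y : ℝ => 4 * y ^ (-3 / 2 : ℝ)) (Ici 1) :=
    (integrableOn_Ici_iff_integrableOn_Ioi).2
      ((integrableOn_Ioi_rpow_of_lt (by norm_num) one_pos).const_mul 4)
  have h0 : 0 ≤ ∫ y in Ici (1 : ℝ), 4 * y ^ (-3 / 2 : ℝ) :=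
    setIntegral_nonneg measurableSet_Ici fun y (hy : 1 ≤ y) => by positivity
  -- The half-width is at most `2 * exp (r / 2) * y ^ (1 / 2)`; the weight `y ^ (-2)` makes this
  -- integrable on `[1, ∞)`. The `+ 1` only makes positivity immediate.
  refine ⟨(∫ y in Ici (1 : ℝ), 4 * y ^ (-3 / 2 : ℝ)) + 1, by linarith, fun r => ?_⟩
  have h1 := area_le (S := regionP ∩ metricY.disc Complex.I r) (measurableSet_Ici (a := (1 : ℝ)))
    (w := fun y => 2 * Real.exp (r / 2) * y ^ (1 / 2 : ℝ)) (by fun_prop) fun z hz => by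
      have hy := pt_mem_regionP.1 hz.1
      refine ⟨hy, abs_le_of_sq_le_sq ?_ (by positivity)⟩
      have := sq_add_sq_le_of_one_le hy (mem_disc_iff.1 hz.2).le
      have hr : Real.exp r = Real.exp (r / 2) ^ 2 := by rw [← Real.exp_nat_mul]; congr 1; ring
      rw [mul_pow, mul_pow, ← hr, ← Real.rpow_mul_natCast (by linarith)]
      norm_num
      nlinarith [sq_nonneg z.im, mul_pos (Real.exp_pos r) (by linarith : 0 < z.im)]
  refine h1.trans ?_
  calc _ ≤ ∫⁻ y in Ici (1 : ℝ), ENNReal.ofReal (Real.exp (r / 2) * (4 * y ^ (-3 / 2 : ℝ))) := by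
        refine setLIntegral_mono (by fun_prop) fun y (hy : 1 ≤ y) => ENNReal.ofReal_le_ofReal ?_
        have hy0 : 0 < y := by linarith
        rw [profile_of_one_le hy]
        have : y ^ (-3 / 2 : ℝ) = (1 / y) ^ 2 * y ^ (1 / 2 : ℝ) := by
          rw [one_div y, inv_pow, ← Real.rpow_natCast, ← Real.rpow_neg hy0.le,
            ← Real.rpow_add hy0]
          norm_num
        rw [this]
        exact le_of_eq (by ring)
    _ = ENNReal.ofReal (∫ y in Ici (1 : ℝ), Real.exp (r / 2) * (4 * y ^ (-3 / 2 : ℝ))) := by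
        refine (ofReal_integral_eq_lintegral_ofReal (hint.const_mul _) ?_).symm
        filter_upwards [ae_restrict_mem measurableSet_Ici] with y hy
        have : (1 : ℝ) ≤ y := hy
        positivity
    _ ≤ _ := by
        rw [integral_const_mul]
        exact ENNReal.ofReal_le_ofReal (by nlinarith [Real.exp_pos (r / 2)])

/-- The area of `Q ∩ D(i, r)` is at most a constant multiple of `exp (r / 2)`. -/
theorem exists_area_regionQ_inter_disc_le : ∃ C : ℝ, 0 < C ∧ ∀ r : ℝ,
    metricY.area (regionQ ∩ metricY.disc Complex.I r) ≤ ENNReal.ofReal (C * Real.exp (r / 2)) := by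
  have hint : IntegrableOn (fun y : ℝ => 96 * Real.exp y) (Iio 1) :=
    ((integrableOn_exp_Iic 1).mono_set Iio_subset_Iic_self).const_mul _
  have h0 : 0 ≤ ∫ y in Iio (1 : ℝ), 96 * Real.exp y :=
    setIntegral_nonneg measurableSet_Iio fun y _ => by positivity
  set c : ℝ := Real.exp (1 / 2) * 2 * Real.exp (-1)
  have hc : 0 < c := by positivity
  refine ⟨c * ((∫ y in Iio (1 : ℝ), 96 * Real.exp y) + 1), by positivity, fun r => ?_⟩
  have h1 := area_le (S := regionQ ∩ metricY.disc Complex.I r) (measurableSet_Iio (a := (1 : ℝ)))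
    (w := fun y => Real.exp (r / 2) * (Real.exp (1 / 2) * 2) * (48 * Real.exp (y - 1) ^ 3))
    (by fun_prop) fun z hz => by
      have hy := pt_mem_regionQ.1 hz.1
      refine ⟨hy, ?_⟩
      set R := Real.exp (1 - z.im)
      have hb : |z.re| ≤ Real.exp (r / 2) * (Real.exp (1 / 2) * 2) * Real.exp (-(R / 2)) := by
        refine abs_le_of_sq_le_sq ?_ (by positivity)
        have := sq_mul_exp_le_of_lt_one hy (mem_disc_iff.1 hz.2).le
        rw [Real.exp_sub R 1, ← mul_div_assoc, div_le_iff₀ (Real.exp_pos 1)] at this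
        have hR := Real.exp_pos R
        have hE : (Real.exp (r / 2) * (Real.exp (1 / 2) * 2) * Real.exp (-(R / 2))) ^ 2 =
            4 * (Real.exp r * Real.exp 1) / Real.exp R := by
          rw [mul_pow, mul_pow, mul_pow, ← Real.exp_nat_mul, ← Real.exp_nat_mul,
            ← Real.exp_nat_mul, show ((2 : ℕ) : ℝ) * (r / 2) = r by push_cast; ring,
            show ((2 : ℕ) : ℝ) * (1 / 2) = 1 by norm_num,
            show ((2 : ℕ) : ℝ) * -(R / 2) = -R by push_cast; ring, Real.exp_neg]
          ring
        rw [hE, le_div_iff₀ hR]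
        nlinarith [mul_pos (Real.exp_pos (z.im - 1)) hR,
          mul_pos (Real.exp_pos r) (Real.exp_pos 1)]
      refine hb.trans (mul_le_mul_of_nonneg_left ?_ (by positivity))
      have hR0 : 0 < R := Real.exp_pos _
      -- `exp (-(R / 2)) ≤ 48 / R ^ 3`: the cube beats the weight `ρ ^ 2 = R ^ 2` and leaves `1 / R
      -- = exp (y - 1)`, integrable towards `-∞`.
      have h3 := Real.pow_div_factorial_le_exp (R / 2) (by positivity) 3
      have h6 : ((Nat.factorial 3 : ℕ) : ℝ) = 6 := by norm_num [Nat.factorial]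
      rw [h6] at h3
      have hinv : Real.exp (z.im - 1) = R⁻¹ := by
        rw [← Real.exp_neg]; congr 1; ring
      rw [Real.exp_neg, hinv, inv_pow, ← div_eq_mul_inv, inv_le_comm₀ (Real.exp_pos _)
        (by positivity), inv_div]
      refine le_trans (le_of_eq ?_) h3
      ring
  refine h1.trans ?_
  calc _ ≤ ∫⁻ y in Iio (1 : ℝ), ENNReal.ofReal ((c * Real.exp (r / 2)) * (96 * Real.exp y)) := by
        refine setLIntegral_mono (by fun_prop) fun y (hy : y < 1) => ENNReal.ofReal_le_ofReal ?_
        rw [profile_of_lt_one hy]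
        have : Real.exp (1 - y) ^ 2 * Real.exp (y - 1) ^ 3 = Real.exp y * Real.exp (-1) := by
          rw [← Real.exp_nat_mul, ← Real.exp_nat_mul, ← Real.exp_add, ← Real.exp_add]
          congr 1
          push_cast
          ring
        calc _ = Real.exp (r / 2) * (Real.exp (1 / 2) * 2) * 96 *
              (Real.exp (1 - y) ^ 2 * Real.exp (y - 1) ^ 3) := by ring
          _ ≤ _ := by
              rw [this]
              exact le_of_eq (by simp only [c]; ring)
    _ = ENNReal.ofReal (∫ y in Iio (1 : ℝ), (c * Real.exp (r / 2)) * (96 * Real.exp y)) :=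
        (ofReal_integral_eq_lintegral_ofReal (hint.const_mul _)
          (.of_forall fun y => by positivity)).symm
    _ ≤ _ := by
        rw [integral_const_mul]
        refine ENNReal.ofReal_le_ofReal ?_
        nlinarith [mul_pos hc (Real.exp_pos (r / 2))]

theorem le_area_inter_disc {r : ℝ} (hr : 6 ≤ r) :
    ENNReal.ofReal (Real.exp (-3) / 8 * Real.exp (r / 2)) ≤
      metricY.area (regionP ∩ metricY.disc Complex.I r) ∧
    ENNReal.ofReal (Real.exp (-3) / 8 * Real.exp (r / 2)) ≤
      metricY.area (regionQ ∩ metricY.disc Complex.I r) := by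
  -- With `s = r / 2 - 3`, points of the box lie at distance at most `2 * s + 4 = r - 2` from `i`.
  have hs : 0 ≤ r / 2 - 3 := by linarith
  have hd : ∀ z : ℂ, z.re ∈ Icc 0 (Real.exp (r / 2 - 3)) → z.im ∈ Icc 0 2 →
      metricY.pt z ∈ metricY.disc Complex.I r := fun z hx hy =>
    mem_disc_iff.2 ((dist_le_of_mem_box hs hx hy).trans_lt (by linarith))
  have he : Real.exp (r / 2 - 3) = Real.exp (-3) * Real.exp (r / 2) := by
    rw [← Real.exp_add]; congr 1; ring
  constructor
  · refine le_trans (ENNReal.ofReal_le_ofReal ?_)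
      (le_area (a := 0) (b := Real.exp (r / 2 - 3)) (c := 1) (d := 2) (k := 1 / 4) (by norm_num)
      (fun z hx hy => ⟨⟨hy.1, hd z hx ⟨by linarith [hy.1], hy.2⟩⟩, quarter_le_sq_profile hy.2⟩)
      (Real.exp_pos _).le)
    rw [he]
    nlinarith [mul_pos (Real.exp_pos (-3)) (Real.exp_pos (r / 2))]
  · refine le_trans (ENNReal.ofReal_le_ofReal ?_)
      -- The box stops at height `1 / 2` to stay inside Q; its height and the bound `1 / 4` for `ρ ^
      -- 2` give the factor `1 / 8`.
      (le_area (a := 0) (b := Real.exp (r / 2 - 3)) (c := 0) (d := 1 / 2) (k := 1 / 4)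
      (by norm_num) (fun z hx hy => ⟨⟨pt_mem_regionQ.2 (by linarith [hy.2]),
        hd z hx ⟨hy.1, by linarith [hy.2]⟩⟩, quarter_le_sq_profile (by linarith [hy.2])⟩)
      (Real.exp_pos _).le)
    rw [he]
    nlinarith [mul_pos (Real.exp_pos (-3)) (Real.exp_pos (r / 2))]

theorem le_area_regionP_inter_disc_of_le_one {r : ℝ} (hr : 0 < r) (hr' : r ≤ 1) :
    ENNReal.ofReal (r ^ 2 / 64) ≤ metricY.area (regionP ∩ metricY.disc Complex.I r) := by
  refine le_trans (ENNReal.ofReal_le_ofReal ?_)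
    (le_area (a := 0) (b := r / 4) (c := 1) (d := 1 + r / 4) (k := 1 / 4) (by norm_num)
    (fun z hx hy => ⟨⟨hy.1, mem_disc_iff.2 ((dist_le_add_of_one_le hx.1 hy.1).trans_lt ?_)⟩,
      quarter_le_sq_profile (by linarith [hy.2])⟩) (by linarith))
  · exact le_of_eq (by ring)
  · linarith [hx.2, hy.2]

theorem area_regionQ_inter_disc_le_of_le_half {r : ℝ} (hr : 0 < r) (hr' : r ≤ 1 / 2) :
    metricY.area (regionQ ∩ metricY.disc Complex.I r) ≤ ENNReal.ofReal (32 * r ^ 2) := by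
  have h1 := area_le (S := regionQ ∩ metricY.disc Complex.I r)
    (measurableSet_Icc (a := 1 - r) (b := 1)) (w := fun _ => 4 * r) (by fun_prop) fun z hz => by
      have hy := pt_mem_regionQ.1 hz.1
      have hd := mem_disc_iff.1 hz.2
      refine ⟨⟨?_, hy.le⟩, ?_⟩
      · have := depth_le_dist z
        rw [depth, if_neg (not_le.2 hy)] at this
        linarith [Real.add_one_le_exp (1 - z.im)]
      · have h2 := arsinh_le_dist z
        set s := Real.arsinh (z.re * profile z.im)
        have hs : |s| ≤ 1 := by linarith
        -- `|sinh s| ≤ 2 * |s|` for `|s| ≤ 1`. As `ρ ≥ 1` on Q and `|s| ≤ 2 * r`, this gives `|x| ≤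
        -- 4 * r`.
        have h3 : |z.re * profile z.im| ≤ 2 * |s| := by
          rw [← Real.sinh_arsinh (z.re * profile z.im)]
          change |Real.sinh s| ≤ _
          rw [Real.sinh_eq]
          have e1 := abs_le.1 (Real.abs_exp_sub_one_le hs)
          have e2 := abs_le.1 (Real.abs_exp_sub_one_le (x := -s) (by rwa [abs_neg]))
          rw [abs_neg] at e2
          exact abs_le.2 ⟨by linarith, by linarith⟩
        rw [abs_mul, abs_of_pos (profile_pos _)] at h3
        nlinarith [one_le_profile_of_le_one hy.le, abs_nonneg z.re]
  refine h1.trans ?_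
  calc _ ≤ ∫⁻ y in Icc (1 - r) 1, ENNReal.ofReal (32 * r) := by
        refine setLIntegral_mono measurable_const fun y hy => ENNReal.ofReal_le_ofReal ?_
        have hp : profile y ≤ 2 := by
          rcases hy.2.eq_or_lt with rfl | h
          · simp [profile]
          · rw [profile_of_lt_one h]
            have := Real.exp_bound_div_one_sub_of_interval (x := 1 - y) (by linarith)
              (by linarith [hy.1])
            refine this.trans ?_
            rw [div_le_iff₀ (by linarith [hy.1])]
            linarith [hy.1]
        have : profile y ^ 2 ≤ 4 := by nlinarith [profile_pos y]
        nlinarith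
    _ = _ := by
        rw [setLIntegral_const, Real.volume_Icc, ← ENNReal.ofReal_mul (by positivity)]
        congr 1
        ring

end metricY

/-! ### The curvature measure. -/

open Filter Topology in
/-- Two locally finite measures on the plane which give the same integral to all smooth functions
with compact support are equal. -/
theorem measure_ext_of_integral_contDiff {μ ν : Measure ℂ} [IsLocallyFiniteMeasure μ]
    [IsLocallyFiniteMeasure ν]
    (h : ∀ φ : ℂ → ℝ, ContDiff ℝ ∞ φ → HasCompactSupport φ → ∫ z, φ z ∂μ = ∫ z, φ z ∂ν) :
    μ = ν := by
  have key : ∀ K : Set ℂ, IsCompact K → μ K = ν K := by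
    intro K hK
    -- A smooth `f` equal to 1 exactly on `K` and vanishing off a ball: its powers are again test
    -- functions and decrease to the indicator of `K`. Regularity then passes from compact sets to
    -- all sets.
    obtain ⟨r, hr⟩ := hK.isBounded.subset_ball 0
    obtain ⟨f, hf, hrange, hsupp, hone⟩ := exists_contMDiff_support_eq_eq_one_iff
      (n := ⊤) 𝓘(ℝ, ℂ) Metric.isOpen_ball hK.isClosed hr
    have hfd : ContDiff ℝ ∞ f := contMDiff_iff_contDiff.1 hf
    have h01 : ∀ z, f z ∈ Icc (0 : ℝ) 1 := fun z => hrange (mem_range_self z)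
    have hzero : ∀ z, z ∉ Metric.ball (0 : ℂ) r → f z = 0 := fun z hz => by
      rw [← hsupp] at hz
      exact Function.notMem_support.1 hz
    have lim : ∀ (m : Measure ℂ) [IsLocallyFiniteMeasure m],
        Tendsto (fun n : ℕ => ∫ z, f z ^ (n + 1) ∂m) atTop (𝓝 (m.real K)) := by
      intro m _
      rw [← integral_indicator_one hK.measurableSet]
      refine tendsto_integral_of_dominated_convergence
        ((Metric.ball (0 : ℂ) r).indicator fun _ => (1 : ℝ))
        (fun n => (hfd.continuous.pow _).aestronglyMeasurable)
        ((integrable_indicator_iff measurableSet_ball).2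
          (integrableOn_const (measure_ball_lt_top.ne)))
        (fun n => .of_forall fun z => ?_) (.of_forall fun z => ?_)
      · rw [Real.norm_of_nonneg (pow_nonneg (h01 z).1 _)]
        by_cases hz : z ∈ Metric.ball (0 : ℂ) r
        · rw [indicator_of_mem hz]
          exact pow_le_one₀ (h01 z).1 (h01 z).2
        · rw [indicator_of_notMem hz, hzero z hz]
          simp
      · by_cases hz : z ∈ K
        · simp [hz, (hone z).1 hz]
        · rw [indicator_of_notMem hz]
          exact (tendsto_pow_atTop_nhds_zero_of_lt_one (h01 z).1
            (lt_of_le_of_ne (h01 z).2 fun he => hz ((hone z).2 he))).comp (tendsto_add_atTop_nat 1)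
    have hlim := (lim μ).congr fun n => h _ (hfd.pow (n + 1)) <| by
      refine HasCompactSupport.of_support_subset_isCompact (isCompact_closedBall (0 : ℂ) r) ?_
      intro z hz
      refine Metric.ball_subset_closedBall (not_not.1 fun hz' => hz ?_)
      simp [hzero z hz']
    exact (measureReal_eq_measureReal_iff hK.measure_lt_top.ne hK.measure_lt_top.ne).1
      (tendsto_nhds_unique hlim (lim ν))
  refine Measure.OuterRegular.ext_isOpen fun U hU => ?_
  refine Measure.InnerRegularWRT.eq_of_innerRegularWRT_of_forall_eq Measure.Regular.innerRegular
    Measure.Regular.innerRegular key hU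

theorem isLocallyFiniteMeasure_add {X : Type*} [TopologicalSpace X] [MeasurableSpace X]
    (μ ν : Measure X) [IsLocallyFiniteMeasure μ] [IsLocallyFiniteMeasure ν] :
    IsLocallyFiniteMeasure (μ + ν) := by
  refine ⟨fun x => ?_⟩
  obtain ⟨s, hs, hμ⟩ := μ.finiteAt_nhds x
  obtain ⟨t, ht, hν⟩ := ν.finiteAt_nhds x
  refine ⟨s ∩ t, Filter.inter_mem hs ht, ?_⟩
  rw [Measure.add_apply]
  exact ENNReal.add_lt_top.2 ⟨(measure_mono inter_subset_left).trans_lt hμ,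
    (measure_mono inter_subset_right).trans_lt hν⟩

theorem integral_complex_eq {F : ℂ → ℝ} (hF : Integrable F) :
    ∫ z, F z = ∫ x : ℝ, ∫ y : ℝ, F ⟨x, y⟩ := by
  rw [← (Complex.volume_preserving_equiv_real_prod.symm).integral_comp
    Complex.measurableEquivRealProd.symm.measurableEmbedding, Measure.volume_eq_prod,
    integral_prod]
  · rfl
  · exact (Complex.volume_preserving_equiv_real_prod.symm).integrable_comp_of_integrable hF

theorem integral_complex_eq_symm {F : ℂ → ℝ} (hF : Integrable F) :
    ∫ z, F z = ∫ y : ℝ, ∫ x : ℝ, F ⟨x, y⟩ := by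
  rw [← (Complex.volume_preserving_equiv_real_prod.symm).integral_comp
    Complex.measurableEquivRealProd.symm.measurableEmbedding, Measure.volume_eq_prod,
    integral_prod_symm]
  · rfl
  · exact (Complex.volume_preserving_equiv_real_prod.symm).integrable_comp_of_integrable hF

namespace metricY

/-- The logarithm of `profile`. -/
noncomputable def logProfile (y : ℝ) : ℝ := if 1 ≤ y then -Real.log y else 1 - y

theorem log_profile (y : ℝ) : Real.log (profile y) = logProfile y := by
  unfold profile logProfile
  split_ifs <;> simp

/-- The derivative of `logProfile`. -/
noncomputable def logProfileDeriv (y : ℝ) : ℝ := if 1 ≤ y then -y⁻¹ else -1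

theorem hasDerivAt_logProfile (y : ℝ) : HasDerivAt logProfile (logProfileDeriv y) y := by
  refine hasDerivAt_ite_one_le (a := fun y => -Real.log y) (a' := fun y => -y⁻¹)
    (b := fun y => 1 - y) (b' := fun _ => -1) (fun x hx => ?_) (fun x _ => ?_) (by simp) (by simp) y
  · exact (Real.hasDerivAt_log (by linarith : x ≠ 0)).fun_neg
  · exact (hasDerivAt_id' x).const_sub 1

theorem continuous_logProfileDeriv : Continuous logProfileDeriv :=
  continuous_if_le continuous_const continuous_id
    (fun y hy => ((continuousAt_inv₀ (by
      have : (1 : ℝ) ≤ y := hy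
      linarith)).neg).continuousWithinAt)
    continuousOn_const (fun y hy => by simp [← hy])

theorem hasDerivAt_logProfileDeriv {y : ℝ} (hy : y ≠ 1) :
    HasDerivAt logProfileDeriv ((Ici 1).indicator (fun y => profile y ^ 2) y) y := by
  rcases lt_or_gt_of_ne hy with h | h
  · rw [indicator_of_notMem (by simpa using h)]
    refine (hasDerivAt_const y (-1 : ℝ)).congr_of_eventuallyEq ?_
    filter_upwards [Iio_mem_nhds h] with x hx
    exact if_neg (not_le.2 hx)
  · rw [indicator_of_mem (by simpa using h.le), profile_of_one_le h.le]
    have : HasDerivAt (fun y : ℝ => -y⁻¹) ((1 / y) ^ 2) y := by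
      simpa using (hasDerivAt_inv (by linarith : y ≠ 0)).fun_neg
    refine this.congr_of_eventuallyEq ?_
    filter_upwards [Ioi_mem_nhds h] with x hx
    exact if_pos (le_of_lt hx)

/-- Green's formula on a vertical line. -/
theorem integral_logProfile_mul {ψ ψ' ψ'' : ℝ → ℝ} (h1 : ∀ y, HasDerivAt ψ (ψ' y) y)
    (h2 : ∀ y, HasDerivAt ψ' (ψ'' y) y) (hc : Continuous ψ'') (hs : HasCompactSupport ψ) :
    ∫ y, logProfile y * ψ'' y = ∫ y, (Ici 1).indicator (fun y => profile y ^ 2) y * ψ y := by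
  have hψ : Continuous ψ := continuous_iff_continuousAt.2 fun y => (h1 y).continuousAt
  have hψ' : Continuous ψ' := continuous_iff_continuousAt.2 fun y => (h2 y).continuousAt
  have hs' : HasCompactSupport ψ' := by
    have := hs.deriv
    rwa [show deriv ψ = ψ' from funext fun y => (h1 y).deriv] at this
  have hs'' : HasCompactSupport ψ'' := by
    have := hs'.deriv
    rwa [show deriv ψ' = ψ'' from funext fun y => (h2 y).deriv] at this
  have hL : Continuous logProfile :=
    continuous_iff_continuousAt.2 fun y => (hasDerivAt_logProfile y).continuousAt
  have i1 : Integrable fun y => logProfile y * ψ'' y :=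
    (hL.mul hc).integrable_of_hasCompactSupport hs''.mul_left
  have i2 : Integrable fun y => (Ici 1).indicator (fun y => profile y ^ 2) y * ψ y := by
    have : Integrable ((Ici (1 : ℝ)).indicator fun y => profile y ^ 2 * ψ y) :=
      (((continuous_profile.pow 2).mul hψ).integrable_of_hasCompactSupport
        hs.mul_left).indicator measurableSet_Ici
    refine this.congr (.of_forall fun y => ?_)
    by_cases hy : y ∈ Ici (1 : ℝ) <;> simp [indicator, hy]
  rw [← sub_eq_zero, ← integral_sub i1 i2]
  obtain ⟨B, hB⟩ := (hs.isCompact.union hs'.isCompact).isBounded.subset_closedBall 0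
  set b := |B| + 1
  have hb : 0 < b := by positivity
  have hzero : ∀ y, b ≤ |y| → ψ y = 0 ∧ ψ' y = 0 ∧ ψ'' y = 0 := by
    intro y hy
    have hy' : y ∉ Metric.closedBall (0 : ℝ) B := by
      simp only [Metric.mem_closedBall, dist_zero_right, Real.norm_eq_abs, not_le]
      linarith [le_abs_self B]
    have hn := fun h => hy' (hB h)
    refine ⟨image_eq_zero_of_notMem_tsupport fun h => hn (.inl h),
      image_eq_zero_of_notMem_tsupport fun h => hn (.inr h), ?_⟩
    rw [← (h2 y).deriv]
    exact image_eq_zero_of_notMem_tsupport fun h => hn (.inr (tsupport_deriv_subset h))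
  have hset : ∫ y, (logProfile y * ψ'' y - (Ici 1).indicator (fun y => profile y ^ 2) y * ψ y) =
      ∫ y in (-b)..b,
        (logProfile y * ψ'' y - (Ici 1).indicator (fun y => profile y ^ 2) y * ψ y) := by
    rw [intervalIntegral.integral_of_le (by linarith)]
    refine (setIntegral_eq_integral_of_forall_compl_eq_zero fun y hy => ?_).symm
    have : b ≤ |y| := by
      by_contra! hlt
      exact hy ⟨(abs_lt.1 hlt).1, (abs_lt.1 hlt).2.le⟩
    simp [hzero y this]
  -- The primitive `L * ψ' - L' * ψ`, with `L = logProfile`, is continuous across `y = 1` because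
  -- `L'` is. The one point where `L''` fails to exist can thus be ignored, and no mass appears on
  -- the line.
  rw [hset, integral_eq_of_hasDerivAt_off_countable_of_le
    (fun y => logProfile y * ψ' y - logProfileDeriv y * ψ y)
    (fun y => logProfile y * ψ'' y - (Ici 1).indicator (fun y => profile y ^ 2) y * ψ y) (by linarith)
    (countable_singleton (1 : ℝ))
    ((hL.mul hψ').sub (continuous_logProfileDeriv.mul hψ)).continuousOn (fun y hy => ?_)
    (i1.sub i2).intervalIntegrable]
  · have e1 := hzero b (le_abs_self b)
    have e2 := hzero (-b) (by rw [abs_neg]; exact le_abs_self b)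
    simp [e1, e2]
  · refine (((hasDerivAt_logProfile y).mul (h2 y)).sub
      ((hasDerivAt_logProfileDeriv hy.2).mul (h1 y))).congr_deriv ?_
    ring

theorem integral_second_deriv_eq_zero {ψ ψ' ψ'' : ℝ → ℝ} (h1 : ∀ y, HasDerivAt ψ (ψ' y) y)
    (h2 : ∀ y, HasDerivAt ψ' (ψ'' y) y) (hc : Continuous ψ'') (hs : HasCompactSupport ψ) :
    ∫ y, ψ'' y = 0 := by
  have hψ' : Continuous ψ' := continuous_iff_continuousAt.2 fun y => (h2 y).continuousAt
  have hs' : HasCompactSupport ψ' := by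
    have := hs.deriv
    rwa [show deriv ψ = ψ' from funext fun y => (h1 y).deriv] at this
  have hs'' : HasCompactSupport ψ'' := by
    have := hs'.deriv
    rwa [show deriv ψ' = ψ'' from funext fun y => (h2 y).deriv] at this
  exact integral_eq_zero_of_hasDerivAt_of_integrable h2
    (hc.integrable_of_hasCompactSupport hs'') (hψ'.integrable_of_hasCompactSupport hs')

theorem hasDerivAt_vertical {E : Type*} [NormedAddCommGroup E] [NormedSpace ℝ E] {f : ℂ → E}
    (hf : Differentiable ℝ f) (x y : ℝ) :
    HasDerivAt (fun y : ℝ => f ⟨x, y⟩) (fderiv ℝ f ⟨x, y⟩ Complex.I) y :=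
  (hf ⟨x, y⟩).hasFDerivAt.comp_hasDerivAt y
    (hasDerivAt_mk (hasDerivAt_const y x) (hasDerivAt_id' y))

theorem hasDerivAt_horizontal {E : Type*} [NormedAddCommGroup E] [NormedSpace ℝ E] {f : ℂ → E}
    (hf : Differentiable ℝ f) (x y : ℝ) :
    HasDerivAt (fun x : ℝ => f ⟨x, y⟩) (fderiv ℝ f ⟨x, y⟩ 1) x :=
  (hf ⟨x, y⟩).hasFDerivAt.comp_hasDerivAt x
    (hasDerivAt_mk (hasDerivAt_id' x) (hasDerivAt_const x y))

theorem hasCompactSupport_vertical {φ : ℂ → ℝ} (hs : HasCompactSupport φ) (x : ℝ) :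
    HasCompactSupport fun y : ℝ => φ ⟨x, y⟩ :=
  .of_support_subset_isCompact (hs.isCompact.image Complex.continuous_im) fun y hy =>
    ⟨⟨x, y⟩, subset_tsupport _ hy, rfl⟩

theorem hasCompactSupport_horizontal {φ : ℂ → ℝ} (hs : HasCompactSupport φ) (y : ℝ) :
    HasCompactSupport fun x : ℝ => φ ⟨x, y⟩ :=
  .of_support_subset_isCompact (hs.isCompact.image Complex.continuous_re) fun x hx =>
    ⟨⟨x, y⟩, subset_tsupport _ hx, rfl⟩

theorem setIntegral_regionP (φ : ℂ → ℝ) :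
    ∫ p in regionP, φ (metricY.coord p) ∂metricY.area =
      ∫ z : ℂ, (Ici 1).indicator (fun y => profile y ^ 2) z.im * φ z := by
  have hP : MeasurableSet {z : ℂ | 1 ≤ z.im} := Complex.measurable_im measurableSet_Ici
  have hm : Measurable fun z : ℂ => ENNReal.ofReal (profile z.im ^ 2) :=
    ((continuous_profile.comp Complex.continuous_im).pow 2).measurable.ennreal_ofReal
  refine (setIntegral_withDensity_eq_setIntegral_toReal_smul (μ := (volume : Measure ℂ)) hm
    (.of_forall fun z => ENNReal.ofReal_lt_top) φ hP).trans ?_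
  rw [← integral_indicator hP]
  refine integral_congr_ae (.of_forall fun z => ?_)
  beta_reduce
  by_cases hz : 1 ≤ z.im
  · rw [indicator_of_mem (show z ∈ {z : ℂ | 1 ≤ z.im} from hz),
      indicator_of_mem (show z.im ∈ Ici 1 from hz), ENNReal.toReal_ofReal (sq_nonneg _),
      smul_eq_mul]
  · rw [indicator_of_notMem (show z ∉ {z : ℂ | 1 ≤ z.im} from hz),
      indicator_of_notMem (show z.im ∉ Ici 1 from hz), zero_mul]

theorem isLocallyFiniteMeasure_area : IsLocallyFiniteMeasure metricY.area :=
  IsLocallyFiniteMeasure.withDensity_ofReal (μ := (volume : Measure ℂ))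
    ((continuous_profile.comp Complex.continuous_im).pow 2)

theorem integral_log_density_mul_laplacian {φ : ℂ → ℝ} (hφ : ContDiff ℝ ∞ φ)
    (hs : HasCompactSupport φ) :
    ∫ z : ℂ, Real.log (metricY.density z) * Laplacian.laplacian φ z =
      ∫ p in regionP, φ (metricY.coord p) ∂metricY.area := by
  have hd : Differentiable ℝ φ := hφ.differentiable (by simp)
  have hφ' : ContDiff ℝ ∞ (fderiv ℝ φ) := hφ.fderiv_right (by simp)
  have hd' : Differentiable ℝ (fderiv ℝ φ) := hφ'.differentiable (by simp)
  have hc'' : Continuous (fderiv ℝ (fderiv ℝ φ)) := hφ'.continuous_fderiv (by simp)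
  have hs'' : HasCompactSupport (fderiv ℝ (fderiv ℝ φ)) := (hs.fderiv ℝ).fderiv ℝ
  have hL : Continuous fun z : ℂ => logProfile z.im :=
    (continuous_iff_continuousAt.2 fun y => (hasDerivAt_logProfile y).continuousAt).comp
      Complex.continuous_im
  have hB : ∀ v : ℂ, Continuous fun z => fderiv ℝ (fderiv ℝ φ) z v v := fun v =>
    (hc''.clm_apply continuous_const).clm_apply continuous_const
  have hi : ∀ v : ℂ, Integrable fun z => logProfile z.im * fderiv ℝ (fderiv ℝ φ) z v v := by
    intro v
    refine (hL.mul (hB v)).integrable_of_hasCompactSupport ?_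
    exact (hs''.comp_left (g := fun T : ℂ →L[ℝ] ℂ →L[ℝ] ℝ => T v v) rfl).mul_left
  have hI : Integrable fun z : ℂ => (Ici 1).indicator (fun y => profile y ^ 2) z.im * φ z := by
    have : Integrable ({z : ℂ | 1 ≤ z.im}.indicator fun z => profile z.im ^ 2 * φ z) :=
      ((((continuous_profile.comp Complex.continuous_im).pow 2).mul
        hφ.continuous).integrable_of_hasCompactSupport hs.mul_left).indicator
        (Complex.measurable_im measurableSet_Ici)
    refine this.congr (.of_forall fun z => ?_)
    by_cases hz : 1 ≤ z.im <;> simp [indicator, hz]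
  have hsplit : ∀ z : ℂ, Real.log (metricY.density z) * Laplacian.laplacian φ z =
      logProfile z.im * fderiv ℝ (fderiv ℝ φ) z 1 1 +
        logProfile z.im * fderiv ℝ (fderiv ℝ φ) z Complex.I Complex.I := fun z => by
    rw [InnerProductSpace.laplacian_eq_iteratedFDeriv_complexPlane, density_eq, log_profile]
    simp [iteratedFDeriv_two_apply, mul_add]
  simp_rw [hsplit]
  -- Each second derivative is integrated first in its own variable: in `x` the factor `log ρ` is
  -- constant and the integral vanishes, while in `y` Green's formula applies.
  rw [integral_add (hi 1) (hi Complex.I), integral_complex_eq_symm (hi 1),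
    integral_complex_eq (hi Complex.I), setIntegral_regionP, integral_complex_eq hI]
  have h0 : ∀ y : ℝ, ∫ x : ℝ, logProfile y * fderiv ℝ (fderiv ℝ φ) ⟨x, y⟩ 1 1 = 0 := fun y => by
    have := integral_second_deriv_eq_zero
      (ψ'' := fun x => fderiv ℝ (fderiv ℝ φ) ⟨x, y⟩ 1 1) (fun x => hasDerivAt_horizontal hd x y)
      (fun x => by simpa using
        (hasDerivAt_horizontal hd' x y).clm_apply (hasDerivAt_const x (1 : ℂ)))
      ((hB 1).comp (contDiff_mk (b := fun _ => y) contDiff_id contDiff_const).continuous)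
      (hasCompactSupport_horizontal hs y)
    rw [integral_const_mul, this, mul_zero]
  simp_rw [h0]
  rw [integral_zero, zero_add]
  refine integral_congr_ae (.of_forall fun x => ?_)
  exact integral_logProfile_mul (fun y => hasDerivAt_vertical hd x y)
    (fun y => by simpa using
      (hasDerivAt_vertical hd' x y).clm_apply (hasDerivAt_const y Complex.I))
    ((hB Complex.I).comp (contDiff_mk contDiff_const contDiff_id).continuous)
    (hasCompactSupport_vertical hs x)

theorem isCurvatureMeasure_iff (ωpos ωneg : Measure metricY.Surface) :
    metricY.IsCurvatureMeasure ωpos ωneg ↔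
      ωpos = 0 ∧ ωneg = metricY.area.restrict regionP := by
  have hA' := isLocallyFiniteMeasure_area
  have hA : IsLocallyFiniteMeasure (metricY.area.restrict regionP) := inferInstance
  constructor
  · rintro ⟨h1, h2, h3, h4⟩
    -- Moving the negative parts across turns the identity of signed measures into one of positive
    -- measures. It forces `ωpos ≤ ωneg`, and mutual singularity then gives `ωpos = 0`.
    have hsum : ωpos + metricY.area.restrict regionP = ωneg := by
      have : IsLocallyFiniteMeasure (ωpos + metricY.area.restrict regionP) :=
        isLocallyFiniteMeasure_add _ _
      refine @measure_ext_of_integral_contDiff (ωpos + metricY.area.restrict regionP) ωneg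
        this h2 fun φ hφ hs => ?_
      have h := h4 φ hφ hs
      rw [integral_log_density_mul_laplacian hφ hs] at h
      have hint : ∀ (m : Measure metricY.Surface) [IsLocallyFiniteMeasure m],
          Integrable (fun p => φ (metricY.coord p)) m := fun m _ =>
        Continuous.integrable_of_hasCompactSupport (X := metricY.Surface) hφ.continuous hs
      have hadd := integral_add_measure (hint ωpos) (hint (metricY.area.restrict regionP))
      have heq : ∫ p, φ (metricY.coord p) ∂ωpos +
          ∫ p in regionP, φ (metricY.coord p) ∂metricY.area =
          ∫ p, φ (metricY.coord p) ∂ωneg := by linarith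
      exact hadd.trans heq
    have hle : ωpos ≤ ωneg := hsum ▸ Measure.le_add_right le_rfl
    have h0 : ωpos = 0 := (Measure.MutuallySingular.self_iff _).1
      (h3.mono_ac Measure.AbsolutelyContinuous.rfl hle.absolutelyContinuous)
    refine ⟨h0, ?_⟩
    rw [← hsum, h0, zero_add]
  · rintro ⟨rfl, rfl⟩
    refine ⟨inferInstance, hA, Measure.MutuallySingular.zero_left, fun φ hφ hs => ?_⟩
    rw [integral_log_density_mul_laplacian hφ hs]
    simp

/-! ### Completeness and conformal type. -/

theorem mem_box_of_dist_le {r : ℝ} {z : ℂ}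
    (h : dist (metricY.pt Complex.I) (metricY.pt z) ≤ r) :
    |z.re| ≤ 2 * Real.exp r + 1 + |r| ∧ |z.im| ≤ 2 * Real.exp r + 1 + |r| := by
  have hK := Real.exp_pos r
  have hr := abs_nonneg r
  by_cases hz : 1 ≤ z.im
  · have h1 := sq_add_sq_le_of_one_le hz h
    have hy : z.im ≤ 2 * Real.exp r := by nlinarith [sq_nonneg z.re]
    have hx : |z.re| ≤ 2 * Real.exp r := abs_le_of_sq_le_sq (by nlinarith) (by positivity)
    rw [abs_of_nonneg (by linarith : 0 ≤ z.im)]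
    exact ⟨by linarith, by linarith⟩
  · have hlt := not_le.1 hz
    have h1 := sq_mul_exp_le_of_lt_one hlt h
    have h2 := (depth_le_dist z).trans h
    rw [depth, if_neg hz] at h2
    have h3 := Real.add_one_le_exp (1 - z.im)
    have h4 : 1 ≤ Real.exp (Real.exp (1 - z.im) - 1) := Real.one_le_exp (by linarith)
    have hx : |z.re| ≤ 2 * Real.exp r + 1 := by
      refine abs_le_of_sq_le_sq ?_ (by positivity)
      nlinarith [sq_nonneg z.re, Real.exp_pos (z.im - 1),
        mul_nonneg (sq_nonneg z.re) (sub_nonneg.2 h4),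
        mul_pos (Real.exp_pos (z.im - 1)) (by linarith : 0 < Real.exp (Real.exp (1 - z.im) - 1))]
    refine ⟨by linarith, abs_le.2 ⟨?_, by linarith⟩⟩
    linarith [le_abs_self r]

instance properSpace : ProperSpace metricY.Surface := by
  refine ProperSpace.of_seq_closedBall (x := metricY.pt Complex.I) Filter.tendsto_id
    (.of_forall fun r : ℝ => ?_)
  set B := 2 * Real.exp r + 1 + |r|
  have hK : IsCompact (X := metricY.Surface) (Icc (-B) B ×ℂ Icc (-B) B) :=
    isCompact_Icc.reProdIm isCompact_Icc
  refine hK.of_isClosed_subset Metric.isClosed_closedBall fun p hp => ?_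
  rw [Metric.mem_closedBall, dist_comm] at hp
  have := mem_box_of_dist_le (z := metricY.coord p) hp
  exact ⟨abs_le.1 this.1, abs_le.1 this.2⟩

end metricY

instance ConformalMetric.simplyConnectedSpace (g : ConformalMetric) :
    SimplyConnectedSpace g.Surface :=
  inferInstanceAs (SimplyConnectedSpace ℂ)

theorem ConformalMetric.isParabolic (g : ConformalMetric) : g.IsParabolic := by
  let F : Diffeomorph 𝓘(ℝ, ℂ) 𝓘(ℝ, ℂ) ℂ g.Surface 1 :=
    { toEquiv := Equiv.refl ℂ
      contMDiff_toFun := contMDiff_id (M := ℂ)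
      contMDiff_invFun := contMDiff_id (M := ℂ) }
  refine ⟨F, fun z => ⟨g.density z, g.density_pos z, fun v => ?_⟩⟩
  have h : mfderiv 𝓘(ℝ, ℂ) 𝓘(ℝ, ℂ) F z = ContinuousLinearMap.id ℝ ℂ := mfderiv_id (M := ℂ)
  refine (g.norm_tangent (F z) _).trans ?_
  rw [h, norm_tangentSpace_vectorSpace]
  rfl

namespace metricY

/-! ### Comparison of the two areas and conclusion. -/

theorem measurableSet_regionP : MeasurableSet regionP :=
  Complex.measurable_im measurableSet_Ici

theorem area_disc (r : ℝ) : metricY.area (metricY.disc Complex.I r) =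
    metricY.area (regionP ∩ metricY.disc Complex.I r) +
      metricY.area (regionQ ∩ metricY.disc Complex.I r) := by
  rw [← measure_inter_add_sdiff _ measurableSet_regionP, inter_comm, inter_comm regionQ]
  congr 2
  ext p
  exact and_congr_right fun _ => not_le (a := (1 : ℝ)) (b := (metricY.coord p).im)

/-- The area of `Q ∩ D(i, r)` is at most a constant multiple of that of `P ∩ D(i, r)`. -/
theorem exists_area_regionQ_le_mul_area_regionP : ∃ K : ℝ, 0 < K ∧ ∀ r : ℝ, 0 < r →
    0 < metricY.area (regionP ∩ metricY.disc Complex.I r) ∧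
    metricY.area (regionQ ∩ metricY.disc Complex.I r) ≤
      ENNReal.ofReal K * metricY.area (regionP ∩ metricY.disc Complex.I r) := by
  obtain ⟨C, hC, hQ⟩ := exists_area_regionQ_inter_disc_le
  set c : ℝ := Real.exp (-3) / 8
  have hc : 0 < c := by positivity
  have hmono : ∀ {r s : ℝ}, r ≤ s → metricY.area (regionP ∩ metricY.disc Complex.I r) ≤
      metricY.area (regionP ∩ metricY.disc Complex.I s) := fun h =>
    measure_mono (inter_subset_inter_right _ (Metric.ball_subset_ball h))
  -- One summand per range of `r`: `2048 = 32 * 64` for `r ≤ 1 / 2`; `256` is the inverse of the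
  -- lower bound `r ^ 2 / 64` at `r = 1 / 2`, used up to `r = 6`; and `C / c` compares the
  -- exponential bounds beyond.
  set K : ℝ := 2048 + C * Real.exp 3 * 256 + C / c
  have hK : 0 < K := by positivity
  have key : ∀ {r q p : ℝ}, 0 < p →
      metricY.area (regionQ ∩ metricY.disc Complex.I r) ≤ ENNReal.ofReal q →
      ENNReal.ofReal p ≤ metricY.area (regionP ∩ metricY.disc Complex.I r) → q ≤ K * p →
      0 < metricY.area (regionP ∩ metricY.disc Complex.I r) ∧
      metricY.area (regionQ ∩ metricY.disc Complex.I r) ≤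
        ENNReal.ofReal K * metricY.area (regionP ∩ metricY.disc Complex.I r) := by
    intro r q p hp hq hp' hqp
    refine ⟨(ENNReal.ofReal_pos.2 hp).trans_le hp', hq.trans ?_⟩
    refine (ENNReal.ofReal_le_ofReal hqp).trans ?_
    rw [ENNReal.ofReal_mul hK.le]
    gcongr
  refine ⟨K, hK, fun r hr => ?_⟩
  rcases le_total r (1 / 2) with h1 | h1
  · refine key (by positivity) (area_regionQ_inter_disc_le_of_le_half hr h1)
      (le_area_regionP_inter_disc_of_le_one hr (by linarith)) ?_
    have : 0 ≤ (C * Real.exp 3 * 256 + C / c) * (r ^ 2 / 64) := by positivity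
    linarith [sq_nonneg r, show K * (r ^ 2 / 64) =
      2048 * (r ^ 2 / 64) + (C * Real.exp 3 * 256 + C / c) * (r ^ 2 / 64) by simp only [K]; ring]
  rcases le_total r 6 with h2 | h2
  · refine key (by norm_num) (hQ r) ((le_area_regionP_inter_disc_of_le_one (r := 1 / 2)
      (by norm_num) (by norm_num)).trans (hmono h1)) ?_
    have : Real.exp (r / 2) ≤ Real.exp 3 := Real.exp_le_exp.2 (by linarith)
    have h3 : C * Real.exp (r / 2) ≤ C * Real.exp 3 := mul_le_mul_of_nonneg_left this hC.le
    have : 0 < C / c := by positivity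
    simp only [K]
    linarith
  · refine key (mul_pos hc (Real.exp_pos _)) (hQ r) (le_area_inter_disc h2).1 ?_
    have h3 : C / c * (c * Real.exp (r / 2)) = C * Real.exp (r / 2) := by field_simp
    have : 0 ≤ (2048 + C * Real.exp 3 * 256) * (c * Real.exp (r / 2)) := by positivity
    calc _ ≤ (2048 + C * Real.exp 3 * 256) * (c * Real.exp (r / 2)) +
          C / c * (c * Real.exp (r / 2)) := by linarith
      _ = _ := by simp only [K]; ring

theorem area_inter_disc_lt_top (r : ℝ) :
    metricY.area (regionP ∩ metricY.disc Complex.I r) < ⊤ ∧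
    metricY.area (regionQ ∩ metricY.disc Complex.I r) < ⊤ := by
  obtain ⟨C, -, hC⟩ := exists_area_regionP_inter_disc_le
  obtain ⟨C', -, hC'⟩ := exists_area_regionQ_inter_disc_le
  exact ⟨(hC r).trans_lt ENNReal.ofReal_lt_top, (hC' r).trans_lt ENNReal.ofReal_lt_top⟩

end metricY

theorem mainTheorem2 :
    CompleteSpace metricY.Surface ∧
    SimplyConnectedSpace metricY.Surface ∧
    metricY.IsParabolic ∧
    metricY.IsAleksandrov ∧
    -- the curvature measure is `-1` times area on `P` and `0` on `Q`; its positive part vanishes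
    (∀ ωpos ωneg : Measure metricY.Surface, metricY.IsCurvatureMeasure ωpos ωneg ↔
      ωpos = 0 ∧ ωneg = metricY.area.restrict regionP) ∧
    (∀ r : ℝ, 0 < r → metricY.area (metricY.disc Complex.I r) < ⊤) ∧
    (∃ ε : ℝ, 0 < ε ∧ ∀ ωpos ωneg : Measure metricY.Surface,
      metricY.IsCurvatureMeasure ωpos ωneg → ∀ r : ℝ, 0 < r →
        ωpos.real (metricY.disc Complex.I r) - ωneg.real (metricY.disc Complex.I r) <
          -ε * metricY.area.real (metricY.disc Complex.I r)) ∧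
    -- for large `r` the area of each of the two parts of the disc is comparable to `exp (r / 2)`
    (∃ c C R : ℝ, 0 < c ∧ ∀ r : ℝ, R ≤ r →
      metricY.area.real (regionP ∩ metricY.disc Complex.I r) ∈
        Icc (c * Real.exp (r / 2)) (C * Real.exp (r / 2)) ∧
      metricY.area.real (regionQ ∩ metricY.disc Complex.I r) ∈
        Icc (c * Real.exp (r / 2)) (C * Real.exp (r / 2))) := by
  refine ⟨inferInstance, inferInstance, metricY.isParabolic,
    ⟨_, _, (metricY.isCurvatureMeasure_iff _ _).2 ⟨rfl, rfl⟩⟩, metricY.isCurvatureMeasure_iff,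
    fun r _ => ?_, ?_, ?_⟩
  · rw [metricY.area_disc]
    exact ENNReal.add_lt_top.2 (metricY.area_inter_disc_lt_top r)
  · obtain ⟨K, hK, h⟩ := metricY.exists_area_regionQ_le_mul_area_regionP
    -- The area of the disc is at most `1 + K` times that of its P part, which is positive; `2 + K`
    -- makes the inequality strict.
    refine ⟨1 / (2 + K), by positivity, fun ωpos ωneg hω r hr => ?_⟩
    obtain ⟨rfl, rfl⟩ := (metricY.isCurvatureMeasure_iff _ _).1 hω
    obtain ⟨hP, hQ⟩ := metricY.area_inter_disc_lt_top r
    obtain ⟨hpos, hle⟩ := h r hr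
    have hpos' := ENNReal.toReal_pos hpos.ne' hP.ne
    have hle' := ENNReal.toReal_mono (ENNReal.mul_lt_top ENNReal.ofReal_lt_top hP).ne hle
    rw [ENNReal.toReal_mul, ENNReal.toReal_ofReal hK.le] at hle'
    rw [measureReal_def, measureReal_def, measureReal_def, metricY.area_disc,
      ENNReal.toReal_add hP.ne hQ.ne, Measure.restrict_apply' metricY.measurableSet_regionP,
      inter_comm _ regionP, Measure.coe_zero, Pi.zero_apply, ENNReal.toReal_zero, zero_sub,
      neg_mul, neg_lt_neg_iff, one_div, inv_mul_lt_iff₀ (by positivity)]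
    linarith
  · obtain ⟨C, hC, hP⟩ := metricY.exists_area_regionP_inter_disc_le
    obtain ⟨C', hC', hQ⟩ := metricY.exists_area_regionQ_inter_disc_le
    refine ⟨Real.exp (-3) / 8, max C C', 6, by positivity, fun r hr => ?_⟩
    obtain ⟨h1, h2⟩ := metricY.le_area_inter_disc hr
    obtain ⟨fP, fQ⟩ := metricY.area_inter_disc_lt_top r
    refine ⟨⟨(ENNReal.ofReal_le_iff_le_toReal fP.ne).1 h1,
      (ENNReal.toReal_le_of_le_ofReal (by positivity) (hP r)).trans ?_⟩,
      ⟨(ENNReal.ofReal_le_iff_le_toReal fQ.ne).1 h2,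
      (ENNReal.toReal_le_of_le_ofReal (by positivity) (hQ r)).trans ?_⟩⟩
    · gcongr
      exact le_max_left _ _
    · gcongr
      exact le_max_right _ _
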